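/- Let $P\subset\mathbb{R}^d$ be a closed convex cone with $P-P=\mathbb{R}^d$ and $P\cap(-P)=\{0\}$. Let $(Y,\mathcal{B})$ be a measurable space with $\mathcal{B}$ countably generated, on which $\mathbb{R}^d$ acts (written additively) by a jointly measurable action, and let $\lambda$ be a $\sigma$-finite $\mathbb{R}^d$-invariant measure on $Y$. Let $X\in\mathcal{B}$ satisfy $X+a\subset X$ for all $a\in P$ and $\bigcap_{a\in P}(X+a)=\emptyset$. Let $\eta$ be a Poisson process on $Y$ with intensity measure $\lambda$, realised on a complete probability space $(\Omega,\mathcal{F},\mathbb{P})$ such that $\mathcal{F}$ is the smallest complete $\sigma$-algebra making all $\eta(B)$, $B\in\mathcal{B}$, measurable. (Thus $\eta$ is a random $\sigma$-finite measure with values in $\mathbb{N}\cup\{\infty\}$; $\eta(B)$ is Poisson distributed with parameter $\lambda(B)$, and is a.s. infinite if $\lambda(B)=\infty$; and $\eta(B_1),\dots,\eta(B_n)$ are independent for disjoint $B_1,\dots,B_n\in\mathcal B$.) For $a,b\in P$ with $b-a\in P$ let $\mathcal{F}_{a,b}$ be the complete $\sigma$-algebra generated by $\eta(B)$, $B\in\mathcal{B}$,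 $B\subset (X+a)\setminus(X+b)$, and put $\mathcal{F}_a=\mathcal{F}_{0,a}$. Then: (i) for all $a,b,c\in P$ with $b-a\in P$ there is a unique unitary $S_c:L^2(\Omega,\mathcal{F}_{a,b},\mathbb{P})\to L^2(\Omega,\mathcal{F}_{a+c,b+c},\mathbb{P})$ such that $S_c\big(\varphi(\eta(B_1),\dots,\eta(B_n))\big)=\varphi(\eta(B_1+c),\dots,\eta(B_n+c))$ for all measurable $B_1,\dots,B_n\subset (X+a)\setminus(X+b)$ and all Borel functions $\varphi$ for which $\varphi(\eta(B_1),\dots,\eta(B_n))$ is square integrable; (ii) the set $E=\{(a,f): a\in P,\ f\in L^2(\Omega,\mathcal{F}_a,\mathbb{P})\}$ is a Borel subset of $P\times L^2(\Omega,\mathcal{F},\mathbb{P})$; (iii) the multiplication $(a,f)(b,g)=(a+b,\,f\,S_a g)$ is well defined on $E$, and $E$, with this multiplication, the projection $p(a,f)=a$, the fibres $E(a)=L^2(\Omega,\mathcal{F}_a,\mathbb{P})$ and the Borel structure inherited from $P\times L^2(\Omega,\mathcal{F},\mathbb{P})$, is a product system over $P$. Here (iii) means: $E$ is a standard Borel space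 and $p$ is Borel; the fibres $E(a)$ are nonzero separable Hilbert spaces, and $E(0)$ is one-dimensional; $E$ together with the set $\Gamma$ of all Borel sections of $p$ is a measurable field of Hilbert spaces (that is, $\Gamma$ is a linear space; $a\mapsto\|s(a)\|$ is Borel for $s\in\Gamma$; every section $r$ such that $a\mapsto\langle r(a),s(a)\rangle$ is Borel for all $s\in\Gamma$ belongs to $\Gamma$; and there are $s_1,s_2,\dots\in\Gamma$ such that $\{s_n(a):n\ge 1\}$ spans a dense subspace of $E(a)$ for every $a$); fibrewise addition, scalar multiplication and inner product are Borel; the multiplication is Borel and associative, and for all $a,b\in P$ it is a bilinear map $E(a)\times E(b)\to E(a+b)$ that extends to a unitary $E(a)\otimes E(b)\to E(a+b)$. -/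

import Mathlib

open MeasureTheory ProbabilityTheory
open scoped ENNReal NNReal Pointwise InnerProductSpace

noncomputable section

/-! ### Measurable fields of Hilbert spaces and product systems -/

/-- The disjoint union `{(a, u) : a ∈ T, u ∈ E a}` of a family of sets. -/
structure TotalSpace {T : Type*} (E : T → Type*) where
  base : T
  vec : E base

/-- A measurable field of separable Hilbert spaces over a measurable space `T`: `Γ` is the
linear space of the sections that are regarded as measurable. -/
structure IsMeasurableField {T : Type*} [MeasurableSpace T] (E : T → Type*)
    [∀ t, NormedAddCommGroup (E t)] [∀ t, InnerProductSpace ℂ (E t)]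
    (Γ : Set (∀ t, E t)) : Prop where
  complete : ∀ t, CompleteSpace (E t)
  separable : ∀ t, TopologicalSpace.SeparableSpace (E t)
  zero_mem : (fun _ => 0) ∈ Γ
  add_mem : ∀ r ∈ Γ, ∀ s ∈ Γ, (fun t => r t + s t) ∈ Γ
  smul_mem : ∀ z : ℂ, ∀ s ∈ Γ, (fun t => z • s t) ∈ Γ
  measurable_norm : ∀ s ∈ Γ, Measurable fun t => ‖s t‖
  mem_of_measurable_inner : ∀ r : ∀ t, E t,
    (∀ s ∈ Γ, Measurable fun t => ⟪s t, r t⟫_ℂ) → r ∈ Γ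
  exists_total : ∃ s : ℕ → ∀ t, E t, (∀ n, s n ∈ Γ) ∧
    ∀ t, Dense (Submodule.span ℂ (Set.range fun n => s n t) : Set (E t))

/-- The fibred square `{(a, u, v) : u, v ∈ E a}`, with the measurable structure it has as a
subset of the square of the total space. -/
structure FibredSquare {T : Type*} (E : T → Type*) where
  base : T
  fst : E base
  snd : E base

instance FibredSquare.instMeasurableSpace {T : Type*} (E : T → Type*)
    [MeasurableSpace (TotalSpace E)] : MeasurableSpace (FibredSquare E) :=
  MeasurableSpace.comap
    (fun x => ((⟨x.base, x.fst⟩, ⟨x.base, x.snd⟩) : TotalSpace E × TotalSpace E)) inferInstance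

/-- Let `ι` be an additive monoid with a measurable structure (a closed convex cone, below), let
`E a` be Hilbert spaces, let the total space of `E` carry a measurable structure, and let
`mul a b : E a × E b → E (a + b)` be maps. They form a product system over `ι` when the total
space is a standard Borel space that makes `E` a measurable field of nonzero separable Hilbert
spaces (with the measurable sections of `(a, u) ↦ a` as distinguished sections) on which the
fibrewise operations are Borel, and `mul` is Borel, associative and induces unitaries
`E a ⊗ E b → E (a + b)`. The fibre over `0` is required to be one-dimensional. -/
structure IsProductSystem {ι : Type*} [AddMonoid ι] [MeasurableSpace ι] (E : ι → Type*)
    [∀ a, NormedAddCommGroup (E a)] [∀ a, InnerProductSpace ℂ (E a)]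
    [MeasurableSpace (TotalSpace E)] (mul : ∀ a b, E a → E b → E (a + b)) : Prop where
  standardBorel : StandardBorelSpace (TotalSpace E)
  measurable_base : Measurable (TotalSpace.base : TotalSpace E → ι)
  measurableField : IsMeasurableField E
    {s | Measurable fun a => (⟨a, s a⟩ : TotalSpace E)}
  nontrivial : ∀ a, Nontrivial (E a)
  finrank_zero : Module.finrank ℂ (E 0) = 1
  measurable_add : Measurable fun x : FibredSquare E =>
    (⟨x.base, x.fst + x.snd⟩ : TotalSpace E)
  measurable_smul : Measurable fun x : ℂ × TotalSpace E =>
    (⟨x.2.base, x.1 • x.2.vec⟩ : TotalSpace E)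
  measurable_inner : Measurable fun x : FibredSquare E => ⟪x.fst, x.snd⟫_ℂ
  add_mul : ∀ a b (u u' : E a) (v : E b), mul a b (u + u') v = mul a b u v + mul a b u' v
  mul_add : ∀ a b (u : E a) (v v' : E b), mul a b u (v + v') = mul a b u v + mul a b u v'
  smul_mul : ∀ a b (z : ℂ) (u : E a) (v : E b), mul a b (z • u) v = z • mul a b u v
  mul_smul : ∀ a b (z : ℂ) (u : E a) (v : E b), mul a b u (z • v) = z • mul a b u v
  inner_mul : ∀ a b (u u' : E a) (v v' : E b),
    ⟪mul a b u v, mul a b u' v'⟫_ℂ = ⟪u, u'⟫_ℂ * ⟪v, v'⟫_ℂ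
  total_mul : ∀ a b, Dense (Submodule.span ℂ
    (Set.range fun x : E a × E b => mul a b x.1 x.2) : Set (E (a + b)))
  mul_assoc : ∀ a b c (u : E a) (v : E b) (w : E c),
    (⟨a + b + c, mul (a + b) c (mul a b u v) w⟩ : TotalSpace E) =
      ⟨a + (b + c), mul a (b + c) u (mul b c v w)⟩
  measurable_mul : Measurable fun x : TotalSpace E × TotalSpace E =>
    (⟨x.1.base + x.2.base, mul x.1.base x.2.base x.1.vec x.2.vec⟩ : TotalSpace E)

/-! ### Poisson processes -/

/-- `η` is a Poisson process on `Y` with intensity measure `lam`, realised on the probability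
space `(Ω, μ)`: a random `ℕ ∪ {∞}`-valued `σ`-finite measure whose values on measurable sets are
Poisson distributed (and almost surely infinite on sets of infinite intensity) and independent on
disjoint sets. -/
structure IsPoissonProcess {Ω Y : Type*} [MeasurableSpace Ω] [MeasurableSpace Y]
    (μ : Measure Ω) (η : Ω → Measure Y) (lam : Measure Y) : Prop where
  measurable : Measurable η
  sigmaFinite : ∀ ω, SigmaFinite (η ω)
  integerValued : ∀ ω (B : Set Y), MeasurableSet B → ∃ n : ℕ∞, η ω B = (n : ℝ≥0∞)
  law : ∀ B : Set Y, MeasurableSet B → lam B ≠ ∞ → ∀ k : ℕ,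
    μ {ω | η ω B = k} =
      ENNReal.ofReal (Real.exp (-(lam B).toReal) * (lam B).toReal ^ k / (k.factorial : ℝ))
  law_top : ∀ B : Set Y, MeasurableSet B → lam B = ∞ → ∀ k : ℕ, μ {ω | η ω B = k} = 0
  indep : ∀ (n : ℕ) (B : Fin n → Set Y), (∀ i, MeasurableSet (B i)) →
    Pairwise (Function.onFun Disjoint B) → iIndepFun (fun i ω => η ω (B i)) μ

/-- The smallest complete `σ`-algebra that makes `η(B)` measurable for every measurable
`B ⊆ L`. -/
@[reducible]
def countAlgebra {Ω Y : Type*} [MeasurableSpace Ω] [MeasurableSpace Y]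
    (μ : Measure Ω) (η : Ω → Measure Y) (L : Set Y) : MeasurableSpace Ω :=
  @eventuallyMeasurableSpace Ω
    (⨆ B : {B : Set Y // MeasurableSet B ∧ B ⊆ L},
      MeasurableSpace.comap (fun ω => η ω B.1) inferInstance) (ae μ) inferInstance

/-! ### The fibres, the shift and the total space -/

section PoissonSystem

variable {d : ℕ} (P : PointedCone ℝ (EuclideanSpace ℝ (Fin d)))
  {Ω Y : Type*} [MeasurableSpace Ω] [MeasurableSpace Y]
  [AddAction (EuclideanSpace ℝ (Fin d)) Y]
  (μ : Measure Ω) (η : Ω → Measure Y) (X : Set Y)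

/-- The region `(X + a) \ (X + b)`. -/
def region (a b : P) : Set Y :=
  ((a : EuclideanSpace ℝ (Fin d)) +ᵥ X) \ ((b : EuclideanSpace ℝ (Fin d)) +ᵥ X)

/-- The closed subspace `L²(Ω, 𝓕_{a,b}, μ)` of `L²(Ω, 𝓕, μ)`, where `𝓕_{a,b}` is the complete
`σ`-algebra generated by `η(B)` for measurable `B ⊆ (X + a) \ (X + b)`. -/
abbrev regionL2 (a b : P) : Submodule ℂ (Lp ℂ 2 μ) :=
  lpMeas ℂ ℂ (countAlgebra μ η (region P X a b)) 2 μ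

/-- `S` is the shift `S_c : L²(Ω, 𝓕_{a,b}, μ) → L²(Ω, 𝓕_{a+c,b+c}, μ)`: it sends
`φ(η(B₁), …, η(Bₙ))` to `φ(η(B₁ + c), …, η(Bₙ + c))`. -/
def IsShift (c a b : P)
    (S : regionL2 P μ η X a b ≃ₗᵢ[ℂ] regionL2 P μ η X (a + c) (b + c)) : Prop :=
  ∀ (n : ℕ) (B : Fin n → Set Y), (∀ i, MeasurableSet (B i)) →
    (∀ i, B i ⊆ region P X a b) →
    ∀ φ : (Fin n → ℝ≥0∞) → ℂ, Measurable φ → ∀ f : regionL2 P μ η X a b,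
      ((f : Lp ℂ 2 μ) : Ω → ℂ) =ᵐ[μ] (fun ω => φ fun i => η ω (B i)) →
      ((S f : Lp ℂ 2 μ) : Ω → ℂ) =ᵐ[μ]
        (fun ω => φ fun i => η ω ((c : EuclideanSpace ℝ (Fin d)) +ᵥ B i))

/-- The fibre `E(a) = L²(Ω, 𝓕_{0,a}, μ)`. -/
abbrev poissonFibre (a : P) : Type _ := regionL2 P μ η X 0 a

/-- `E = {(a, f) : a ∈ P, f ∈ E(a)}` with the measurable structure it has as a subset of
`P × L²(Ω, 𝓕, μ)`, both factors with their Borel structure. -/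
instance poissonTotalSpace : MeasurableSpace (TotalSpace (poissonFibre P μ η X)) :=
  MeasurableSpace.comap (fun x => ((x.base, (x.vec : Lp ℂ 2 μ)) : P × Lp ℂ 2 μ))
    (@Prod.instMeasurableSpace P (Lp ℂ 2 μ) inferInstance (borel _))

end PoissonSystem

end

/-!
The product system is carried by the counts of the process. Since all events are determined by the
family `ω ↦ (η ω B)_B` up to null sets, every `f ∈ L²(μ)` is a function `φ` of this family
(`exists_eq_comp_counts`). The invariance of the intensity makes the families `(η B)_B` and
`(η (c + B))_B` equal in law (`map_counts_eq`), because the joint law of finitely many counts is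
determined by the independent Poisson counts of the atoms they generate. Hence `φ((η B)_B)` and
`φ((η (c + B))_B)` have the same norm, which yields a linear isometry `U c` of the whole of `L²(μ)`
(`exists_isCountShift`); the shifts of the statement are its restrictions, and they are unique
because the functions of finitely many counts in a region exhaust a dense subspace
(`exists_isShift`, `IsCountShift.eq_of_isShift`).

For `f` in the fibre over `a` and `g` in the fibre over `b`, the factors `f` and `U a g` depend on
the process in the disjoint regions `X \ (a + X)` and `(a + X) \ (a + b + X)`, so they are
independent. Thus the product is square integrable, and its inner products factorise
(`inner_mulL2_shift`). The products span a dense subspace of the fibre over `a + b`, since events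
about the two regions generate all events about their union (`mem_closure_span_mulL2_shift`).

The Borel structure comes from a countable family of events. The σ-algebra of `Y` has a countable
generating algebra. The intersections `A k` of its members with the pieces of a partition of `Y`
into sets of finite intensity are rich enough for the indicators of the events
`{η (A k ∩ R) = n, …}` to be total in the `L²` space of every region `R`
(`mem_closure_span_countEvent`). As `R` runs through the regions `X \ (a + X)`, the indicators of
these events form a sequence of Borel sections that is fundamental in each fibre
(`isFundamentalSequence_countEvent`); Borel dependence on `a` rests on a version of `η` that is an
s-finite kernel. For closed subspaces of a separable Hilbert space, a fundamental sequence gives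
everything else: the graph `{(a, f) : f ∈ E a}` is Borel because the distance to `E a` is Borel in
`(a, f)`, and the Borel sections form a measurable field. The multiplication is Borel on the
fundamental sections, and the norm of a product is the product of the norms, so that
approximation by combinations of these sections makes it Borel everywhere
(`measurable_mulL2_shift`).
-/

noncomputable section

/-! ### Measurability of maps into a metric space and into a Hilbert space -/

/-- A map into a metric space is Borel as soon as countably many Borel maps approximate it
pointwise arbitrarily well, with measurable error bounds. -/
theorem measurable_of_dist_le {Z H J : Type*} [MeasurableSpace Z] [PseudoMetricSpace H]
    [MeasurableSpace H] [BorelSpace H] [Countable J] {F : Z → H} {G : J → Z → H}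
    {r : J → Z → ℝ} (hG : ∀ j, Measurable (G j)) (hr : ∀ j, Measurable (r j))
    (hd : ∀ j z, dist (F z) (G j z) ≤ r j z) (hinf : ∀ z, ∀ ε > 0, ∃ j, r j z < ε) :
    Measurable F := by
  refine measurable_of_isOpen fun U hU => ?_
  have key : F ⁻¹' U = ⋃ (j : J) (n : ℕ), {z | r j z < 1 / ((n : ℝ) + 1)} ∩
      G j ⁻¹' {x | ENNReal.ofReal (1 / ((n : ℝ) + 1)) ≤ Metric.infEDist x Uᶜ} := by
    ext z
    simp only [Set.mem_preimage, Set.mem_iUnion, Set.mem_inter_iff, Set.mem_ofPred_eq]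
    constructor
    · intro hz
      obtain ⟨ε, hε, hball⟩ := Metric.isOpen_iff.1 hU _ hz
      obtain ⟨n, hn⟩ := exists_nat_one_div_lt (half_pos hε)
      obtain ⟨j, hj⟩ := hinf z (1 / ((n : ℝ) + 1)) (by positivity)
      refine ⟨j, n, hj, Metric.le_infEDist.2 fun y hy => ?_⟩
      rw [edist_dist]
      refine ENNReal.ofReal_le_ofReal ?_
      by_contra! hlt
      refine hy (hball ?_)
      have h1 := dist_triangle (F z) (G j z) y
      rw [Metric.mem_ball, dist_comm]
      linarith [hd j z]
    · rintro ⟨j, n, hj, hdist⟩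
      by_contra hz
      have h1 : Metric.infEDist (G j z) Uᶜ ≤ edist (G j z) (F z) :=
        Metric.infEDist_le_edist_of_mem hz
      have h2 := hdist.trans h1
      rw [edist_dist, ENNReal.ofReal_le_ofReal_iff dist_nonneg, dist_comm] at h2
      linarith [hd j z]
  rw [key]
  refine MeasurableSet.iUnion fun j => MeasurableSet.iUnion fun n => ?_
  refine (measurableSet_lt (hr j) measurable_const).inter (hG j ?_)
  exact (isClosed_le continuous_const Metric.continuous_infEDist).measurableSet

/-- Weak measurability against countably many Borel vector fields that come arbitrarily close to
the values of `F` implies measurability of `F`. -/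
theorem measurable_of_measurable_inner {Z H J : Type*} [MeasurableSpace Z]
    [NormedAddCommGroup H] [InnerProductSpace ℂ H] [MeasurableSpace H] [BorelSpace H]
    [Countable J] {F : Z → H} {s : J → Z → H} (hs : ∀ j, Measurable (s j))
    (hF : ∀ j, Measurable fun z => ⟪s j z, F z⟫_ℂ)
    (hcl : ∀ z, F z ∈ closure (Set.range fun j => s j z)) : Measurable F := by
  have hnorm : Measurable fun z => ‖F z‖ := by
    refine measurable_of_Iic fun t => ?_
    rcases lt_or_ge t 0 with ht | ht
    · convert MeasurableSet.empty using 1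
      ext z
      simp only [Set.mem_preimage, Set.mem_Iic, Set.mem_empty_iff_false, iff_false, not_le]
      exact ht.trans_le (norm_nonneg _)
    -- the norm of `F z` is the supremum of its pairings with a family that approximates it
    have key : (fun z => ‖F z‖) ⁻¹' Set.Iic t = ⋂ j, {z | ‖⟪s j z, F z⟫_ℂ‖ ≤ t * ‖s j z‖} := by
      ext z
      simp only [Set.mem_preimage, Set.mem_Iic, Set.mem_iInter, Set.mem_ofPred_eq]
      constructor
      · intro h j
        refine (norm_inner_le_norm _ _).trans ?_
        rw [mul_comm]
        exact mul_le_mul_of_nonneg_right h (norm_nonneg _)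
      · intro h
        have hc : IsClosed {y : H | ‖⟪y, F z⟫_ℂ‖ ≤ t * ‖y‖} :=
          isClosed_le (by fun_prop) (by fun_prop)
        have h1 : ‖⟪F z, F z⟫_ℂ‖ ≤ t * ‖F z‖ :=
          closure_minimal (by rintro _ ⟨j, rfl⟩; exact h j) hc (hcl z)
        rw [inner_self_eq_norm_sq_to_K] at h1
        simp only [Complex.coe_algebraMap, norm_pow, Complex.norm_real, norm_norm] at h1
        by_contra! hlt
        nlinarith [norm_nonneg (F z)]
    rw [key]
    exact MeasurableSet.iInter fun j =>
      measurableSet_le (hF j).norm (measurable_const.mul (hs j).norm)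
  -- the distance from `F z` to `s j z`, expanded so that its measurability is visible
  refine measurable_of_dist_le (G := s)
    (r := fun j z => √(‖F z‖ ^ 2 - 2 * (⟪s j z, F z⟫_ℂ).re + ‖s j z‖ ^ 2)) hs
    (fun j => ?_) (fun j z => ?_) fun z ε hε => ?_
  · exact (((hnorm.pow_const 2).sub
      (measurable_const.mul (Complex.measurable_re.comp (hF j)))).add
        ((hs j).norm.pow_const 2)).sqrt
  · refine Real.le_sqrt_of_sq_le (le_of_eq ?_)
    rw [dist_eq_norm, @norm_sub_sq ℂ, inner_re_symm]
    rfl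
  · obtain ⟨_, ⟨j, rfl⟩, hj⟩ := Metric.mem_closure_iff.1 (hcl z) ε hε
    refine ⟨j, ?_⟩
    rw [dist_eq_norm] at hj
    rw [Real.sqrt_lt' hε]
    have h2 : ‖F z - s j z‖ ^ 2 = ‖F z‖ ^ 2 - 2 * (⟪s j z, F z⟫_ℂ).re + ‖s j z‖ ^ 2 := by
      rw [@norm_sub_sq ℂ, inner_re_symm]
      rfl
    rw [← h2]
    exact pow_lt_pow_left₀ hj (norm_nonneg _) two_ne_zero

/-- Finite linear combinations of a sequence with coefficients in a countable dense set of
scalars. The countable index `⟨n, k⟩` stands for the combination of the first `n` terms in which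
the coefficient of the `i`-th term is the scalar numbered `k i`. -/
def denseCombination {H : Type*} [AddCommGroup H] [Module ℂ H] (e : ℕ → H)
    (j : Σ n : ℕ, Fin n → ℕ) : H :=
  ∑ i : Fin j.1, TopologicalSpace.denseSeq ℂ (j.2 i) • e i

theorem denseCombination_mem_span {H : Type*} [AddCommGroup H] [Module ℂ H] (e : ℕ → H)
    (j : Σ n : ℕ, Fin n → ℕ) : denseCombination e j ∈ Submodule.span ℂ (Set.range e) :=
  Submodule.sum_mem _ fun i _ => Submodule.smul_mem _ _ (Submodule.subset_span ⟨i, rfl⟩)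

theorem closure_span_subset_closure_denseCombination {H : Type*} [NormedAddCommGroup H]
    [NormedSpace ℂ H] (e : ℕ → H) :
    closure (Submodule.span ℂ (Set.range e) : Set H) ⊆
      closure (Set.range (denseCombination e)) := by
  refine closure_minimal (fun x hx => ?_) isClosed_closure
  obtain ⟨c, rfl⟩ := (Finsupp.mem_span_range_iff_exists_finsupp).1 hx
  obtain ⟨n, hn⟩ : ∃ n : ℕ, c.support ⊆ Finset.range n := by
    obtain ⟨n, hn⟩ := c.support.exists_nat_subset_range
    exact ⟨n, hn⟩
  have hsum : (c.sum fun i a => a • e i) = ∑ i : Fin n, c i • e i := by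
    rw [Finsupp.sum_of_support_subset c hn _ (by simp), ← Fin.sum_univ_eq_sum_range
      (fun i => c i • e i) n]
  rw [hsum]
  have hd : DenseRange fun (k : Fin n → ℕ) (i : Fin n) => TopologicalSpace.denseSeq ℂ (k i) :=
    DenseRange.piMap fun _ => TopologicalSpace.denseRange_denseSeq ℂ
  have hcont : Continuous fun (a : Fin n → ℂ) => ∑ i : Fin n, a i • e i := by fun_prop
  have := map_mem_closure (f := fun (a : Fin n → ℂ) => ∑ i : Fin n, a i • e i)
    (t := Set.range (denseCombination e)) hcont (hd fun i => c i) ?_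
  · exact this
  · rintro _ ⟨k, rfl⟩
    exact ⟨⟨n, k⟩, rfl⟩

theorem measurable_denseCombination {Z H : Type*} [MeasurableSpace Z] [NormedAddCommGroup H]
    [NormedSpace ℂ H] [MeasurableSpace H] [BorelSpace H] [SecondCountableTopology H]
    {e : ℕ → Z → H} (he : ∀ n, Measurable (e n)) (j : Σ n : ℕ, Fin n → ℕ) :
    Measurable fun z => denseCombination (fun n => e n z) j := by
  unfold denseCombination
  exact Finset.measurable_sum _ fun i _ => (he _).const_smul _

/-! ### Measurable fields of closed subspaces of a Hilbert space -/

theorem StandardBorelSpace.of_measurableEquiv {A B : Type*} [MeasurableSpace A]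
    [MeasurableSpace B] [StandardBorelSpace B] (f : A ≃ᵐ B) : StandardBorelSpace A := by
  let := upgradeStandardBorel B
  let : TopologicalSpace A := TopologicalSpace.induced f inferInstance
  have h1 : PolishSpace A := f.toEquiv.polishSpace_induced
  have h2 : BorelSpace A := by
    refine ⟨?_⟩
    rw [borel_comap, ← BorelSpace.measurable_eq (α := B)]
    exact f.measurableEmbedding.comap_eq.symm
  infer_instance

theorem dense_span_range_of_subset_closure {H ι : Type*} [NormedAddCommGroup H] [NormedSpace ℂ H]
    {K : Submodule ℂ H} {v : ι → K}
    (h : (K : Set H) ⊆ closure (Submodule.span ℂ (Set.range fun i => (v i : H)) : Set H)) :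
    Dense (Submodule.span ℂ (Set.range v) : Set K) := by
  intro x
  rw [Topology.IsInducing.subtypeVal.closure_eq_preimage_closure_image, Set.mem_preimage]
  have himage := Submodule.map_span K.subtype (Set.range v)
  rw [← Set.range_comp] at himage
  have hx : (x : H) ∈ closure (Submodule.span ℂ (Set.range (K.subtype ∘ v)) : Set H) := h x.2
  rw [← himage] at hx
  exact hx

section SubspaceField

variable {T H : Type*} [NormedAddCommGroup H] [InnerProductSpace ℂ H] {K : T → Submodule ℂ H}

/-- The inclusion of the total space of a field of subspaces into the product of the base and the
ambient space. -/
def totalInclusion (K : T → Submodule ℂ H) (x : TotalSpace fun t => K t) : T × H :=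
  (x.base, x.vec)

theorem totalInclusion_injective : Function.Injective (totalInclusion K) := by
  rintro ⟨t, u⟩ ⟨t', u'⟩ h
  obtain ⟨rfl, h2⟩ := Prod.mk.inj h
  obtain rfl := Subtype.ext h2
  rfl

variable [MeasurableSpace T] [MeasurableSpace H]

/-- The sections `e n` form a fundamental sequence of the family `K` of closed subspaces:
they are measurable as maps into the ambient space, and their values span a dense subspace of each
`K t`. -/
structure IsFundamentalSequence (K : T → Submodule ℂ H) (e : ℕ → T → H) : Prop where
  isClosed : ∀ t, IsClosed (K t : Set H)
  measurable : ∀ n, Measurable (e n)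
  mem : ∀ n t, e n t ∈ K t
  subset_closure : ∀ t, (K t : Set H) ⊆
    closure (Submodule.span ℂ (Set.range fun n => e n t) : Set H)

variable {e : ℕ → T → H}

theorem IsFundamentalSequence.denseCombination_mem (h : IsFundamentalSequence K e)
    (j : Σ n : ℕ, Fin n → ℕ) (t : T) : denseCombination (fun n => e n t) j ∈ K t :=
  Submodule.span_le.2 (by rintro _ ⟨n, rfl⟩; exact h.mem n t) (denseCombination_mem_span _ j)

theorem IsFundamentalSequence.subset_closure_denseCombination (h : IsFundamentalSequence K e)
    (t : T) : (K t : Set H) ⊆ closure (Set.range (denseCombination fun n => e n t)) :=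
  (h.subset_closure t).trans (closure_span_subset_closure_denseCombination _)

section Total

variable [mK : MeasurableSpace (TotalSpace fun t => K t)]

/-- With the measurable structure inherited from the product of the base and the ambient space, a
map into the total space is measurable if both of its components are. -/
theorem measurable_toTotalSpace
    (hm : mK = MeasurableSpace.comap (totalInclusion K) inferInstance)
    {Z : Type*} [MeasurableSpace Z] {F : Z → TotalSpace fun t => K t}
    (h1 : Measurable fun z => (F z).base) (h2 : Measurable fun z => ((F z).vec : H)) :
    Measurable F := by
  subst hm
  exact measurable_comap_iff.2 (h1.prodMk h2)

theorem measurable_totalInclusion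
    (hm : mK = MeasurableSpace.comap (totalInclusion K) inferInstance) :
    Measurable (totalInclusion K) := by
  subst hm
  exact comap_measurable _

theorem measurable_fibredSquare_inclusion
    (hm : mK = MeasurableSpace.comap (totalInclusion K) inferInstance) :
    Measurable fun x : FibredSquare fun t => K t => (x.base, (x.fst : H), (x.snd : H)) := by
  have h : Measurable fun x : FibredSquare fun t => K t =>
      ((⟨x.base, x.fst⟩, ⟨x.base, x.snd⟩) :
        (TotalSpace fun t => K t) × (TotalSpace fun t => K t)) := comap_measurable _
  have h1 := (measurable_totalInclusion hm).comp h.fst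
  have h2 := (measurable_totalInclusion hm).comp h.snd
  exact h1.fst.prodMk (h1.snd.prodMk h2.snd)

variable [BorelSpace H] [SecondCountableTopology H]

theorem measurable_totalSpace_add
    (hm : mK = MeasurableSpace.comap (totalInclusion K) inferInstance) :
    Measurable fun x : FibredSquare fun t => K t =>
    (⟨x.base, x.fst + x.snd⟩ : TotalSpace fun t => K t) := by
  have h := measurable_fibredSquare_inclusion hm
  exact measurable_toTotalSpace hm h.fst (h.snd.fst.add h.snd.snd)

theorem measurable_totalSpace_smul
    (hm : mK = MeasurableSpace.comap (totalInclusion K) inferInstance) :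
    Measurable fun x : ℂ × TotalSpace fun t => K t =>
    (⟨x.2.base, x.1 • x.2.vec⟩ : TotalSpace fun t => K t) := by
  have h := (measurable_totalInclusion hm).comp
    (measurable_snd : Measurable (Prod.snd : ℂ × (TotalSpace fun t => K t) → _))
  exact measurable_toTotalSpace hm h.fst (measurable_fst.smul h.snd)

theorem measurable_totalSpace_inner
    (hm : mK = MeasurableSpace.comap (totalInclusion K) inferInstance) :
    Measurable fun x : FibredSquare fun t => K t => ⟪x.fst, x.snd⟫_ℂ := by
  have h := measurable_fibredSquare_inclusion hm
  exact h.snd.fst.inner h.snd.snd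

end Total

variable [BorelSpace H] [SecondCountableTopology H]

/-- The graph of the field is Borel: a vector belongs to `K t` precisely when it is at distance
zero from countably many Borel sections. -/
theorem IsFundamentalSequence.measurableSet_graph (h : IsFundamentalSequence K e) :
    MeasurableSet {x : T × H | x.2 ∈ K x.1} := by
  have key : {x : T × H | x.2 ∈ K x.1} = ⋂ m : ℕ, ⋃ j : (Σ n : ℕ, Fin n → ℕ),
      {x | dist x.2 (denseCombination (fun n => e n x.1) j) < 1 / ((m : ℝ) + 1)} := by
    ext ⟨t, x⟩
    simp only [Set.mem_ofPred_eq, Set.mem_iInter, Set.mem_iUnion]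
    constructor
    · intro hx m
      obtain ⟨_, ⟨j, rfl⟩, hj⟩ := Metric.mem_closure_iff.1
        (h.subset_closure_denseCombination t hx) (1 / ((m : ℝ) + 1)) (by positivity)
      exact ⟨j, hj⟩
    · intro hx
      rw [← SetLike.mem_coe, ← (h.isClosed t).closure_eq, Metric.mem_closure_iff]
      intro ε hε
      obtain ⟨m, hm⟩ := exists_nat_one_div_lt hε
      obtain ⟨j, hj⟩ := hx m
      exact ⟨_, h.denseCombination_mem j t, hj.trans hm⟩
  rw [key]
  refine MeasurableSet.iInter fun m => MeasurableSet.iUnion fun j =>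
    measurableSet_lt ?_ (by fun_prop)
  exact measurable_snd.dist ((measurable_denseCombination h.measurable j).comp measurable_fst)

variable [CompleteSpace H] [mK : MeasurableSpace (TotalSpace fun t => K t)]

theorem IsFundamentalSequence.standardBorelSpace [StandardBorelSpace T]
    (h : IsFundamentalSequence K e)
    (hm : mK = MeasurableSpace.comap (totalInclusion K) inferInstance) :
    StandardBorelSpace (TotalSpace fun t => K t) := by
  have : StandardBorelSpace {x : T × H | x.2 ∈ K x.1} := h.measurableSet_graph.standardBorel
  let f : (TotalSpace fun t => K t) ≃ᵐ {x : T × H | x.2 ∈ K x.1} :=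
    { toFun := fun x => ⟨totalInclusion K x, x.vec.2⟩
      invFun := fun x => ⟨x.1.1, ⟨x.1.2, x.2⟩⟩
      left_inv := fun _ => rfl
      right_inv := fun _ => rfl
      measurable_toFun := (measurable_totalInclusion hm).subtype_mk
      measurable_invFun := measurable_toTotalSpace hm (by fun_prop) (by fun_prop) }
  exact .of_measurableEquiv f

/-- A field of closed subspaces with a fundamental sequence is a measurable field of Hilbert
spaces, with the Borel sections of its total space as distinguished sections. -/
theorem IsFundamentalSequence.isMeasurableField (h : IsFundamentalSequence K e)
    (hm : mK = MeasurableSpace.comap (totalInclusion K) inferInstance) :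
    IsMeasurableField (fun t => K t)
      {s | Measurable fun t => (⟨t, s t⟩ : TotalSpace fun t => K t)} := by
  have hiff : ∀ s : ∀ t, K t, (Measurable fun t => (⟨t, s t⟩ : TotalSpace fun t => K t)) ↔
      Measurable fun t => (s t : H) := fun s =>
    ⟨fun hs => ((measurable_totalInclusion hm).comp hs).snd,
      fun hs => measurable_toTotalSpace hm measurable_id hs⟩
  simp only [hiff]
  refine ⟨fun t => (h.isClosed t).completeSpace_coe, fun t => inferInstance, measurable_const,
    fun r hr s hs => hr.add hs, fun z s hs => hs.const_smul z, fun s hs => hs.norm,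
    fun r hr => ?_, fun n t => ⟨e n t, h.mem n t⟩, fun n => h.measurable n, fun t => ?_⟩
  · refine measurable_of_measurable_inner (measurable_denseCombination h.measurable)
      (fun j => ?_) fun t => h.subset_closure_denseCombination t (r t).2
    exact hr (fun t => ⟨denseCombination (fun n => e n t) j, h.denseCombination_mem j t⟩)
      (measurable_denseCombination h.measurable j)
  · exact dense_span_range_of_subset_closure (h.subset_closure t)

end SubspaceField

/-! ### Completed `σ`-algebras and event vectors in `L²` -/

/-- Completion of a `σ`-algebra does not enlarge the class of almost everywhere equivalence classes
of measurable functions. -/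
theorem aestronglyMeasurable_of_eventuallyMeasurableSpace {Ω E : Type*} {m0 : MeasurableSpace Ω}
    [MeasurableSpace Ω] {μ : Measure Ω} [TopologicalSpace E]
    [TopologicalSpace.IsCompletelyMetrizableSpace E] [Nonempty E] {f : Ω → E}
    (hf : AEStronglyMeasurable[@eventuallyMeasurableSpace Ω m0 (ae μ) inferInstance] f μ) :
    AEStronglyMeasurable[m0] f μ := by
  obtain ⟨g, hg, hfg⟩ := hf
  suffices h : ∃ k, StronglyMeasurable[m0] k ∧ g =ᵐ[μ] k by
    obtain ⟨k, hk, hgk⟩ := h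
    exact ⟨k, hk, hfg.trans hgk⟩
  clear hfg
  induction g, hg using StronglyMeasurable.induction' with
  | const z => exact ⟨fun _ => z, stronglyMeasurable_const, .rfl⟩
  | @pcw g₁ g₂ s hg₁ hg₂ hs h₁ h₂ =>
    obtain ⟨t, ht, hst⟩ := hs
    obtain ⟨k₁, hk₁, e₁⟩ := h₁
    obtain ⟨k₂, hk₂, e₂⟩ := h₂
    classical
    refine ⟨t.piecewise k₁ k₂, hk₁.piecewise ht hk₂, ?_⟩
    filter_upwards [hst.mem_iff, e₁, e₂] with ω h h1 h2
    by_cases hω : ω ∈ t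
    · rw [Set.piecewise_eq_of_mem _ _ _ hω, Set.piecewise_eq_of_mem _ _ _ (h.2 hω), h1]
    · rw [Set.piecewise_eq_of_notMem _ _ _ hω, Set.piecewise_eq_of_notMem _ _ _ (mt h.1 hω), h2]
  | @lim g i hg hi h₁ h₂ =>
    choose k hk e using h₁
    refine ⟨fun ω => Filter.atTop.limUnder (k · ω),
      @StronglyMeasurable.limUnder _ _ _ m0 _ _ _ _ _ _ _ hk, ?_⟩
    filter_upwards [ae_all_iff.2 e] with ω hω
    rw [Filter.Tendsto.limUnder_eq]
    simpa only [← hω] using h₂ ω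

theorem eventuallyMeasurableSpace_le {Ω : Type*} {m0 : MeasurableSpace Ω}
    [mΩ : MeasurableSpace Ω] {μ : Measure Ω} [μ.IsComplete] (h : m0 ≤ mΩ) :
    @eventuallyMeasurableSpace Ω m0 (ae μ) inferInstance ≤ mΩ := by
  rintro s ⟨t, ht, hst⟩
  exact ((h t ht).nullMeasurableSet.congr hst.symm).measurable_of_complete

theorem measurable_congr_eventuallyMeasurableSpace {Ω E : Type*} {m0 : MeasurableSpace Ω}
    [MeasurableSpace Ω] {μ : Measure Ω} [MeasurableSpace E] {f g : Ω → E}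
    (hf : Measurable[@eventuallyMeasurableSpace Ω m0 (ae μ) inferInstance] f) (h : g =ᵐ[μ] f) :
    Measurable[@eventuallyMeasurableSpace Ω m0 (ae μ) inferInstance] g :=
  EventuallyMeasurable.congr hf h

theorem eventuallyMeasurableSpace_mono {Ω : Type*} {m0 m1 : MeasurableSpace Ω}
    [MeasurableSpace Ω] {μ : Measure Ω}
    (h : m0 ≤ @eventuallyMeasurableSpace Ω m1 (ae μ) inferInstance) :
    @eventuallyMeasurableSpace Ω m0 (ae μ) inferInstance ≤
      @eventuallyMeasurableSpace Ω m1 (ae μ) inferInstance := by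
  rintro s ⟨t, ht, hst⟩
  obtain ⟨u, hu, htu⟩ := h t ht
  exact ⟨u, hu, hst.trans htu⟩

section EventVector

variable {Ω : Type*} {m0 : MeasurableSpace Ω} [mΩ : MeasurableSpace Ω] (μ : Measure Ω)
  [IsFiniteMeasure μ]

open Classical in
/-- The indicator function of an event as an element of `L²`; the value for sets that are not
measurable is `0`. -/
def eventVector (s : Set Ω) : Lp ℂ 2 μ :=
  if h : MeasurableSet s then indicatorConstLp 2 h (measure_ne_top μ s) 1 else 0

variable {μ}

theorem eventVector_of_measurableSet {s : Set Ω} (hs : MeasurableSet s) :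
    eventVector μ s = indicatorConstLp 2 hs (measure_ne_top μ s) 1 :=
  dif_pos hs

theorem eventVector_coeFn {s : Set Ω} (hs : MeasurableSet s) :
    (eventVector μ s : Ω → ℂ) =ᵐ[μ] s.indicator fun _ => 1 := by
  rw [eventVector_of_measurableSet hs]
  exact indicatorConstLp_coeFn

theorem eventVector_congr {s t : Set Ω} (hs : MeasurableSet s) (ht : MeasurableSet t)
    (h : s =ᵐ[μ] t) : eventVector μ s = eventVector μ t :=
  Lp.ext (((eventVector_coeFn hs).trans (indicator_ae_eq_of_ae_eq_set h)).trans
    (eventVector_coeFn ht).symm)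

theorem eventVector_mem_lpMeas (hm : m0 ≤ mΩ) {s : Set Ω}
    (hs : MeasurableSet[m0] s) : eventVector μ s ∈ lpMeas ℂ ℂ m0 2 μ := by
  rw [eventVector_of_measurableSet (hm s hs)]
  exact mem_lpMeas_indicatorConstLp hm hs _

/-- The indicators of the events of a generating `π`-system are total in the space of square
integrable functions. -/
theorem mem_of_eventVector_mem (hm : m0 ≤ mΩ) {C : Set (Set Ω)}
    (hgen : m0 = MeasurableSpace.generateFrom C) (hC : IsPiSystem C)
    {V : Submodule ℂ (Lp ℂ 2 μ)} (hV : IsClosed (V : Set (Lp ℂ 2 μ)))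
    (huniv : eventVector μ Set.univ ∈ V) (h : ∀ s ∈ C, eventVector μ s ∈ V)
    {f : Lp ℂ 2 μ} (hf : AEStronglyMeasurable[m0] f μ) : f ∈ V := by
  have hev : ∀ s, MeasurableSet[m0] s → eventVector μ s ∈ V := by
    refine MeasurableSpace.induction_on_inter hgen hC ?_ h ?_ ?_
    · have : eventVector μ (∅ : Set Ω) = 0 := by
        rw [eventVector_of_measurableSet .empty, indicatorConstLp_empty]
      rw [this]
      exact V.zero_mem
    · intro t ht hVt
      have : eventVector μ tᶜ = eventVector μ Set.univ - eventVector μ t := by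
        refine Lp.ext ?_
        filter_upwards [eventVector_coeFn (μ := μ) (hm t ht).compl,
          eventVector_coeFn (μ := μ) (hm t ht), eventVector_coeFn (μ := μ) .univ,
          Lp.coeFn_sub (eventVector μ Set.univ) (eventVector μ t)] with ω h1 h2 h3 h4
        rw [h4, Pi.sub_apply, h1, h2, h3]
        by_cases hω : ω ∈ t <;> simp [hω]
      rw [this]
      exact V.sub_mem huniv hVt
    · intro g hdis hg hVg
      let t : ℕ → Set Ω := fun n => ⋃ i < n, g i
      have ht : ∀ n, MeasurableSet[m0] (t n) := fun n =>
        MeasurableSet.iUnion fun i => MeasurableSet.iUnion fun _ => hg i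
      have htV : ∀ n, eventVector μ (t n) ∈ V := by
        intro n
        induction n with
        | zero =>
          have : t 0 = ∅ := by simp [t]
          rw [this, eventVector_of_measurableSet .empty, indicatorConstLp_empty]
          exact V.zero_mem
        | succ n ih =>
          have hsucc : t (n + 1) = t n ∪ g n := by
            simp only [t, Set.biUnion_lt_succ]
          have hd : Disjoint (t n) (g n) := by
            simp only [t, Set.disjoint_iUnion_left]
            exact fun i hi => hdis hi.ne
          have := indicatorConstLp_disjoint_union (p := 2) (hm _ (ht n)) (hm _ (hg n))
            (measure_ne_top μ _) (measure_ne_top μ _) hd (1 : ℂ)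
          rw [hsucc, eventVector_of_measurableSet ((hm _ (ht n)).union (hm _ (hg n))), this,
            ← eventVector_of_measurableSet, ← eventVector_of_measurableSet]
          exact V.add_mem ih (hVg n)
      have hlim : Filter.Tendsto (fun n => eventVector μ (t n)) Filter.atTop
          (nhds (eventVector μ (⋃ n, g n))) := by
        have hU : MeasurableSet (⋃ n, g n) := MeasurableSet.iUnion fun n => hm _ (hg n)
        simp only [eventVector_of_measurableSet hU,
          fun n => eventVector_of_measurableSet (μ := μ) (hm _ (ht n))]
        refine tendsto_indicatorConstLp_set (by simp) ?_
        have htail := tendsto_measure_biUnion_Ici_zero_of_pairwise_disjoint (μ := μ)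
          (fun n => (hm _ (hg n)).nullMeasurableSet) hdis
        refine tendsto_of_tendsto_of_tendsto_of_le_of_le tendsto_const_nhds htail
          (fun _ => zero_le) fun n => measure_mono ?_
        rintro ω (⟨h1, h2⟩ | ⟨h1, h2⟩)
        · simp only [t, Set.mem_iUnion] at h1
          obtain ⟨i, _, hi⟩ := h1
          exact absurd (Set.mem_iUnion.2 ⟨i, hi⟩) h2
        · obtain ⟨i, hi⟩ := Set.mem_iUnion.1 h1
          refine Set.mem_biUnion (x := i) ?_ hi
          by_contra hlt
          exact h2 (Set.mem_iUnion₂.2 ⟨i, not_le.1 hlt, hi⟩)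
      exact hV.mem_of_tendsto hlim (Filter.Eventually.of_forall htV)
  refine Lp.induction_stronglyMeasurable hm (by simp) (fun f => f ∈ V) ?_ ?_ ?_ f hf
  · intro c s hs hμs
    have : (Lp.simpleFunc.indicatorConst 2 (hm s hs) hμs.ne c : Lp ℂ 2 μ) =
        c • eventVector μ s := by
      rw [eventVector_of_measurableSet (hm s hs), Lp.simpleFunc.coe_indicatorConst]
      refine Lp.ext ?_
      filter_upwards [indicatorConstLp_coeFn (p := 2) (hs := hm s hs) (hμs := hμs.ne) (c := c),
        indicatorConstLp_coeFn (p := 2) (hs := hm s hs) (hμs := measure_ne_top μ s) (c := (1 : ℂ)),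
        Lp.coeFn_smul c (indicatorConstLp 2 (hm s hs) (measure_ne_top μ s) (1 : ℂ))]
        with ω h1 h2 h3
      rw [h3, Pi.smul_apply, h1, h2]
      by_cases hω : ω ∈ s <;> simp [hω]
    rw [this]
    exact V.smul_mem _ (hev s hs)
  · intro f g _ _ _ _ _ hf hg
    exact V.add_mem hf hg
  · exact hV.preimage continuous_subtype_val

variable [SecondCountableTopology (Lp ℂ 2 μ)] [MeasurableSpace (Lp ℂ 2 μ)] [BorelSpace (Lp ℂ 2 μ)]

/-- The indicators of a jointly measurable family of events depend measurably on the parameter. -/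
theorem measurable_eventVector {Z : Type*} [MeasurableSpace Z] {D : Z → Set Ω}
    (hD : MeasurableSet {x : Z × Ω | x.2 ∈ D x.1}) : Measurable fun z => eventVector μ (D z) := by
  refine measurable_of_measurable_inner
    (s := fun (n : ℕ) _ => TopologicalSpace.denseSeq (Lp ℂ 2 μ) n)
    (fun n => measurable_const) (fun n => ?_)
    fun z => TopologicalSpace.denseRange_denseSeq (Lp ℂ 2 μ) _
  set v := TopologicalSpace.denseSeq (Lp ℂ 2 μ) n
  have hz : ∀ z, MeasurableSet (D z) := fun z => measurable_prodMk_left hD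
  have key : ∀ z, ⟪v, eventVector μ (D z)⟫_ℂ =
      (starRingEnd ℂ) (∫ ω, {x : Z × Ω | x.2 ∈ D x.1}.indicator (fun x => v x.2) (z, ω) ∂μ) := by
    intro z
    rw [← inner_conj_symm, eventVector_of_measurableSet (hz z), L2.inner_indicatorConstLp_one,
      ← integral_indicator (hz z)]
    rfl
  simp only [key]
  refine (Complex.continuous_conj.measurable).comp (StronglyMeasurable.measurable ?_)
  refine StronglyMeasurable.integral_prod_right
    (f := fun z ω => {x : Z × Ω | x.2 ∈ D x.1}.indicator (fun x => v x.2) (z, ω)) ?_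
  exact ((Lp.stronglyMeasurable v).comp_measurable measurable_snd).indicator hD

end EventVector

/-! ### Finite-dimensional laws of a Poisson process -/

/-- Two probability measures on `[0, ∞]` that are carried by `ℕ ∪ {∞}` and agree on every natural
number are equal. -/
theorem measure_ext_of_natCast_singleton {ν ν' : Measure ℝ≥0∞} [IsProbabilityMeasure ν]
    [IsProbabilityMeasure ν']
    (h : ∀ᵐ x ∂ν, x ∈ Set.range fun n : ℕ∞ => (n : ℝ≥0∞))
    (h' : ∀ᵐ x ∂ν', x ∈ Set.range fun n : ℕ∞ => (n : ℝ≥0∞))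
    (hk : ∀ k : ℕ, ν {(k : ℝ≥0∞)} = ν' {(k : ℝ≥0∞)}) : ν = ν' := by
  have hsum : ∀ (ρ : Measure ℝ≥0∞) (S : Set ℝ≥0∞), S.Countable → ρ S = ∑' x : S, ρ {x.1} := by
    intro ρ S hS
    conv_lhs => rw [← Set.biUnion_of_singleton S]
    exact measure_biUnion hS (fun x _ y _ hxy => Set.disjoint_singleton.2 hxy)
      fun x _ => measurableSet_singleton x
  have htop : ∀ ρ : Measure ℝ≥0∞, IsProbabilityMeasure ρ →
      (∀ᵐ x ∂ρ, x ∈ Set.range fun n : ℕ∞ => (n : ℝ≥0∞)) →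
      ρ {∞} = 1 - ρ (Set.range fun k : ℕ => (k : ℝ≥0∞)) := by
    intro ρ _ hρ
    rw [← prob_compl_eq_one_sub (Set.countable_range _).measurableSet]
    refine measure_congr ?_
    filter_upwards [hρ] with x hx
    obtain ⟨n, rfl⟩ := hx
    refine propext ⟨fun hn => ?_, fun hn => ?_⟩
    · rintro ⟨k, hk⟩
      exact ENNReal.natCast_ne_top k (Eq.trans hk hn)
    · induction n with
      | top => exact ENat.toENNReal_top
      | coe k => exact absurd ⟨k, by simp⟩ hn
  have hpt : ∀ n : ℕ∞, ν {(n : ℝ≥0∞)} = ν' {(n : ℝ≥0∞)} := by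
    intro n
    induction n with
    | coe k => simpa using hk k
    | top =>
      rw [ENat.toENNReal_top, htop ν inferInstance h, htop ν' inferInstance h',
        hsum ν _ (Set.countable_range _), hsum ν' _ (Set.countable_range _)]
      congr 1
      refine tsum_congr ?_
      rintro ⟨_, k, rfl⟩
      exact hk k
  refine Measure.ext fun S hS => ?_
  have hres : ∀ ρ : Measure ℝ≥0∞, (∀ᵐ x ∂ρ, x ∈ Set.range fun n : ℕ∞ => (n : ℝ≥0∞)) →
      ρ S = ρ (S ∩ Set.range fun n : ℕ∞ => (n : ℝ≥0∞)) := by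
    intro ρ hρ
    refine measure_congr ?_
    filter_upwards [hρ] with x hx
    exact propext ⟨fun hS => ⟨hS, hx⟩, fun hS => hS.1⟩
  have hc : (S ∩ Set.range fun n : ℕ∞ => (n : ℝ≥0∞)).Countable :=
    (Set.countable_range _).mono Set.inter_subset_right
  rw [hres ν h, hres ν' h', hsum ν _ hc, hsum ν' _ hc]
  refine tsum_congr ?_
  rintro ⟨_, _, n, rfl⟩
  exact hpt n

section Atoms

variable {ι Y : Type*}

/-- The atom of the field of sets generated by the family `B` that lies in exactly those `B i`
with `i ∈ s`. -/
def atom (B : ι → Set Y) (s : Finset ι) : Set Y := {y | ∀ i, y ∈ B i ↔ i ∈ s}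

theorem pairwise_disjoint_atom (B : ι → Set Y) :
    Pairwise (Function.onFun Disjoint (atom B)) := by
  intro s t hst
  rw [Function.onFun, Set.disjoint_left]
  intro y hs ht
  exact hst (Finset.ext fun i => (hs i).symm.trans (ht i))

theorem measurableSet_atom [MeasurableSpace Y] [Countable ι] {B : ι → Set Y}
    (hB : ∀ i, MeasurableSet (B i)) (s : Finset ι) : MeasurableSet (atom B s) := by
  have : atom B s = ⋂ i, {y | y ∈ B i ↔ i ∈ s} := by
    ext y
    simp [atom]
  rw [this]
  refine MeasurableSet.iInter fun i => ?_
  by_cases hi : i ∈ s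
  · simp only [hi, iff_true]
    exact hB i
  · simp only [hi, iff_false]
    exact (hB i).compl

theorem measure_eq_sum_atom [MeasurableSpace Y] [Fintype ι] [DecidableEq ι] {B : ι → Set Y}
    (hB : ∀ i, MeasurableSet (B i)) (ρ : Measure Y) (i : ι) :
    ρ (B i) = ∑ s : Finset ι, if i ∈ s then ρ (atom B s) else 0 := by
  rw [← Finset.sum_filter, ← measure_biUnion_finset
    (fun s _ t _ hst => pairwise_disjoint_atom B hst) fun s _ => measurableSet_atom hB s]
  congr 1
  ext y
  simp only [Finset.mem_filter, Finset.mem_univ, true_and, Set.mem_iUnion, exists_prop]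
  constructor
  · intro hy
    classical
    exact ⟨Finset.univ.filter fun i => y ∈ B i, by simpa using hy, by simp [atom]⟩
  · rintro ⟨s, hi, hs⟩
    exact (hs i).2 hi

/-- Sums of the counts of atoms, which recover the counts of the sets themselves, depend measurably
on the counts of the atoms. -/
theorem measurable_sum_atoms [DecidableEq ι] {κ : Type*} (R : Type*) [Fintype R]
    (m : R → Finset ι) (f : κ → ι) :
    Measurable fun (x : R → ℝ≥0∞) (i : κ) => ∑ s, if f i ∈ m s then x s else 0 :=
  measurable_pi_lambda _ fun i => Finset.measurable_sum _ fun s _ => by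
    split_ifs
    · exact measurable_pi_apply s
    · exact measurable_const

end Atoms

namespace IsPoissonProcess

variable {Ω Y : Type*} [MeasurableSpace Ω] [MeasurableSpace Y] {μ : Measure Ω}
  {η : Ω → Measure Y} {lam : Measure Y}

theorem measurable_count (hη : IsPoissonProcess μ η lam) {B : Set Y} (hB : MeasurableSet B) :
    Measurable fun ω => η ω B :=
  (Measure.measurable_coe hB).comp hη.measurable

theorem ae_count_lt_top [IsProbabilityMeasure μ] (hη : IsPoissonProcess μ η lam) {B : Set Y}
    (hB : MeasurableSet B) (hlam : lam B ≠ ∞) : ∀ᵐ ω ∂μ, η ω B < ∞ := by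
  have hmeas : ∀ k : ℕ, MeasurableSet {ω | η ω B = k} := fun k =>
    hη.measurable_count hB (measurableSet_singleton _)
  have hone : μ (⋃ k : ℕ, {ω | η ω B = k}) = 1 := by
    rw [measure_iUnion _ hmeas]
    · simp only [hη.law B hB hlam]
      have hs : HasSum (fun k : ℕ => Real.exp (-(lam B).toReal) * (lam B).toReal ^ k /
          (k.factorial : ℝ)) 1 := hasSum_one_poissonMeasure (lam B).toNNReal
      rw [← ENNReal.ofReal_tsum_of_nonneg (fun k => by positivity) hs.summable, hs.tsum_eq,
        ENNReal.ofReal_one]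
    · intro j k hjk
      refine Set.disjoint_left.2 fun ω h1 h2 => hjk ?_
      have : (j : ℝ≥0∞) = k := h1.symm.trans h2
      exact_mod_cast this
  have h1 : ∀ᵐ ω ∂μ, ω ∈ ⋃ k : ℕ, {ω | η ω B = k} :=
    (prob_compl_eq_zero_iff (MeasurableSet.iUnion hmeas)).2 hone
  filter_upwards [h1] with ω hω
  obtain ⟨k, hk⟩ := Set.mem_iUnion.1 hω
  have hk' : η ω B = k := hk
  rw [hk']
  exact ENNReal.natCast_lt_top k

/-- The law of the number of points in a set depends only on the intensity of the set. -/
theorem map_count_eq [IsProbabilityMeasure μ] (hη : IsPoissonProcess μ η lam) {B B' : Set Y}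
    (hB : MeasurableSet B) (hB' : MeasurableSet B') (h : lam B = lam B') :
    μ.map (fun ω => η ω B) = μ.map (fun ω => η ω B') := by
  have h1 := Measure.isProbabilityMeasure_map (μ := μ) (hη.measurable_count hB).aemeasurable
  have h2 := Measure.isProbabilityMeasure_map (μ := μ) (hη.measurable_count hB').aemeasurable
  have hr : MeasurableSet (Set.range fun n : ℕ∞ => (n : ℝ≥0∞)) :=
    (Set.countable_range _).measurableSet
  refine measure_ext_of_natCast_singleton ?_ ?_ fun k => ?_
  · refine (ae_map_iff (hη.measurable_count hB).aemeasurable hr).2 ?_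
    exact ae_of_all _ fun ω => (hη.integerValued ω B hB).imp fun _ h => h.symm
  · refine (ae_map_iff (hη.measurable_count hB').aemeasurable hr).2 ?_
    exact ae_of_all _ fun ω => (hη.integerValued ω B' hB').imp fun _ h => h.symm
  · rw [Measure.map_apply (hη.measurable_count hB) (measurableSet_singleton _),
      Measure.map_apply (hη.measurable_count hB') (measurableSet_singleton _)]
    change μ {ω | η ω B = k} = μ {ω | η ω B' = k}
    by_cases hinf : lam B = ∞
    · rw [hη.law_top B hB hinf, hη.law_top B' hB' (h ▸ hinf)]
    · rw [hη.law B hB hinf, hη.law B' hB' (h ▸ hinf), h]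

theorem iIndepFun_count (hη : IsPoissonProcess μ η lam) {κ : Type*} [Fintype κ] {A : κ → Set Y}
    (hA : ∀ k, MeasurableSet (A k)) (hd : Pairwise (Function.onFun Disjoint A)) :
    iIndepFun (fun k ω => η ω (A k)) μ := by
  have h := hη.indep (Fintype.card κ) (fun i => A ((Fintype.equivFin κ).symm i)) (fun i => hA _)
    fun i j hij => hd fun h => hij ((Fintype.equivFin κ).symm.injective h)
  have := h.precomp (Fintype.equivFin κ).injective
  simpa using this

/-- The joint law of the counts of finitely many sets is determined by the intensities of the
atoms of the field of sets that they generate. -/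
theorem map_counts_eq [IsProbabilityMeasure μ] (hη : IsPoissonProcess μ η lam) {ι : Type*}
    [Fintype ι] {B B' : ι → Set Y} (hB : ∀ i, MeasurableSet (B i))
    (hB' : ∀ i, MeasurableSet (B' i)) (h : ∀ s, lam (atom B s) = lam (atom B' s)) :
    μ.map (fun ω i => η ω (B i)) = μ.map (fun ω i => η ω (B' i)) := by
  classical
  have hatoms : μ.map (fun ω s => η ω (atom B s)) = μ.map (fun ω s => η ω (atom B' s)) := by
    rw [(iIndepFun_iff_map_fun_eq_pi_map fun s =>
        (hη.measurable_count (measurableSet_atom hB s)).aemeasurable).1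
        (hη.iIndepFun_count (measurableSet_atom hB) (pairwise_disjoint_atom B)),
      (iIndepFun_iff_map_fun_eq_pi_map fun s =>
        (hη.measurable_count (measurableSet_atom hB' s)).aemeasurable).1
        (hη.iIndepFun_count (measurableSet_atom hB') (pairwise_disjoint_atom B'))]
    congr 1
    ext1 s
    exact hη.map_count_eq (measurableSet_atom hB s) (measurableSet_atom hB' s) (h s)
  have hsum : ∀ {C : ι → Set Y}, (∀ i, MeasurableSet (C i)) → μ.map (fun ω i => η ω (C i)) =
      (μ.map (fun ω s => η ω (atom C s))).map
        fun (x : Finset ι → ℝ≥0∞) (i : ι) => ∑ s, if i ∈ s then x s else 0 := by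
    intro C hC
    have hg : Measurable fun (x : Finset ι → ℝ≥0∞) (i : ι) => ∑ s, if i ∈ s then x s else 0 :=
      measurable_sum_atoms _ id id
    rw [Measure.map_map hg (measurable_pi_lambda _ fun s =>
      hη.measurable_count (measurableSet_atom hC s))]
    congr 1
    funext ω i
    exact measure_eq_sum_atom hC (η ω) i
  rw [hsum hB, hsum hB', hatoms]

/-- The restrictions of a Poisson process to disjoint sets are independent. -/
theorem indepFun_counts [IsProbabilityMeasure μ] (hη : IsPoissonProcess μ η lam) {ι κ : Type*}
    {B : ι → Set Y} {C : κ → Set Y} (hB : ∀ i, MeasurableSet (B i)) (hC : ∀ j, MeasurableSet (C j))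
    (hd : ∀ i j, Disjoint (B i) (C j)) :
    IndepFun (fun ω i => η ω (B i)) (fun ω j => η ω (C j)) μ := by
  classical
  refine IndepFun.process_indepFun_process (fun i => hη.measurable_count (hB i))
    (fun j => hη.measurable_count (hC j)) fun I J => ?_
  let D : I ⊕ J → Set Y := Sum.elim (fun i => B i) fun j => C j
  have hD : ∀ k, MeasurableSet (D k) := by
    rintro (i | j)
    · exact hB i
    · exact hC j
  have hatom := measurableSet_atom hD
  let S : Finset (Finset (I ⊕ J)) := Finset.univ.filter fun s => ∃ i, Sum.inl i ∈ s
  let T : Finset (Finset (I ⊕ J)) := Finset.univ.filter fun s => ¬ ∃ i, Sum.inl i ∈ s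
  have hST : Disjoint S T := Finset.disjoint_filter_filter_not _ _ _
  have hind := (hη.iIndepFun_count hatom (pairwise_disjoint_atom D)).indepFun_finset S T hST
    fun s => hη.measurable_count (hatom s)
  have h1 : (fun ω (i : I) => η ω (B i)) =
      (fun (x : S → ℝ≥0∞) (i : I) => ∑ s, if Sum.inl i ∈ s.1 then x s else 0) ∘
        fun ω (s : S) => η ω (atom D s) := by
    funext ω i
    rw [Function.comp_apply,
      Finset.sum_coe_sort S fun s => if Sum.inl i ∈ s then η ω (atom D s) else 0,
      Finset.sum_subset (Finset.subset_univ S)]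
    · exact measure_eq_sum_atom hD (η ω) (Sum.inl i)
    · intro s _ hs
      refine if_neg fun hi => hs ?_
      simpa [S] using ⟨_, _, hi⟩
  have h2 : (fun ω (j : J) => η ω (C j)) =
      (fun (x : T → ℝ≥0∞) (j : J) => ∑ s, if Sum.inr j ∈ s.1 then x s else 0) ∘
        fun ω (s : T) => η ω (atom D s) := by
    funext ω j
    rw [Function.comp_apply,
      Finset.sum_coe_sort T fun s => if Sum.inr j ∈ s then η ω (atom D s) else 0,
      Finset.sum_subset (Finset.subset_univ T)]
    · exact measure_eq_sum_atom hD (η ω) (Sum.inr j)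
    · intro s _ hs
      split_ifs with hj
      · -- an atom inside both some `B i` and `C j` is empty
        have : ∃ i, Sum.inl i ∈ s := by
          by_contra hcon
          exact hs (Finset.mem_filter.2 ⟨Finset.mem_univ _, hcon⟩)
        obtain ⟨i, hi⟩ := this
        have hempty : atom D s = ∅ := Set.eq_empty_of_forall_notMem fun y hy =>
          Set.disjoint_left.1 (hd i j) ((hy (Sum.inl i)).2 hi) ((hy (Sum.inr j)).2 hj)
        rw [hempty, measure_empty]
      · rfl
  rw [h1, h2]
  exact hind.comp (measurable_sum_atoms S Subtype.val Sum.inl)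
    (measurable_sum_atoms T Subtype.val Sum.inr)

end IsPoissonProcess

/-! ### A countable family of sets that determines the process -/

/-- A countable family of sets of finite intensity that generates the `σ`-algebra in the sense of
Dynkin classes: a class of sets that contains the family and is closed under proper differences
inside sets of finite intensity and under countable disjoint unions contains all measurable sets. -/
structure IsDynkinGenerating {Y : Type*} [MeasurableSpace Y] (lam : Measure Y) (A : ℕ → Set Y) :
    Prop where
  measurableSet : ∀ n, MeasurableSet (A n)
  measure_ne_top : ∀ n, lam (A n) ≠ ∞
  induction : ∀ p : Set Y → Prop, (∀ n, p (A n)) →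
    (∀ B C, MeasurableSet B → MeasurableSet C → B ⊆ C → lam C ≠ ∞ → p B → p C → p (C \ B)) →
    (∀ f : ℕ → Set Y, Pairwise (Function.onFun Disjoint f) → (∀ i, MeasurableSet (f i)) →
      (∀ i, p (f i)) → p (⋃ i, f i)) →
    ∀ B, MeasurableSet B → p B

/-- Intersect a countable generating algebra with the pieces of a partition into sets of finite
intensity. -/
theorem exists_isDynkinGenerating {Y : Type*} [MeasurableSpace Y]
    [MeasurableSpace.CountablyGenerated Y] (lam : Measure Y) [SigmaFinite lam] :
    ∃ A : ℕ → Set Y, IsDynkinGenerating lam A := by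
  let G : Set (Set Y) := generateSetAlgebra (MeasurableSpace.countableGeneratingSet Y)
  have hG : IsSetAlgebra G := isSetAlgebra_generateSetAlgebra
  have hGgen : ‹MeasurableSpace Y› = MeasurableSpace.generateFrom G := by
    rw [generateFrom_generateSetAlgebra_eq, MeasurableSpace.generateFrom_countableGeneratingSet]
  have hGm : ∀ s ∈ G, MeasurableSet s := fun s hs => by
    rw [hGgen]
    exact MeasurableSpace.measurableSet_generateFrom hs
  obtain ⟨g, hg⟩ : ∃ g : ℕ → Set Y, G = Set.range g := (countable_generateSetAlgebra
    MeasurableSpace.countable_countableGeneratingSet : G.Countable).exists_eq_range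
      ⟨_, hG.univ_mem⟩
  let W : ℕ → Set Y := disjointed (spanningSets lam)
  have hWm : ∀ n, MeasurableSet (W n) := MeasurableSet.disjointed (measurableSet_spanningSets lam)
  have hWfin : ∀ n, lam (W n) ≠ ∞ := fun n =>
    ((measure_mono (disjointed_subset _ n)).trans_lt (measure_spanningSets_lt_top lam n)).ne
  have hWd : Pairwise (Function.onFun Disjoint W) := disjoint_disjointed _
  have hWU : ⋃ n, W n = Set.univ := by rw [iUnion_disjointed, iUnion_spanningSets]
  refine ⟨fun n => g n.unpair.1 ∩ W n.unpair.2, fun n => ?_, fun n => ?_, ?_⟩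
  · exact (hGm _ (by rw [hg]; exact Set.mem_range_self _)).inter (hWm _)
  · exact ((measure_mono Set.inter_subset_right).trans_lt (hWfin _).lt_top).ne
  · intro p hA hdiff hunion B hB
    have hbasic : ∀ s ∈ G, ∀ n, p (s ∩ W n) := by
      intro s hs n
      rw [hg] at hs
      obtain ⟨j, rfl⟩ := hs
      simpa using hA (Nat.pair j n)
    have hW : ∀ n, p (W n) := fun n => by simpa using hbasic _ hG.univ_mem n
    have hpiece : ∀ n, ∀ B, MeasurableSet B → p (B ∩ W n) := by
      intro n
      refine MeasurableSpace.induction_on_inter hGgen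
        (fun s hs t ht _ => hG.inter_mem hs ht) ?_ (fun t ht => hbasic t ht n) ?_ ?_
      · simpa using hdiff (W n) (W n) (hWm n) (hWm n) le_rfl (hWfin n) (hW n) (hW n)
      · intro t ht hpt
        have := hdiff (t ∩ W n) (W n) (ht.inter (hWm n)) (hWm n) Set.inter_subset_right (hWfin n)
          hpt (hW n)
        rwa [Set.sdiff_inter_self_eq_sdiff, Set.sdiff_eq, Set.inter_comm] at this
      · intro f hd hf hpf
        rw [Set.iUnion_inter]
        exact hunion _ (fun i j hij => (hd hij).mono Set.inter_subset_left Set.inter_subset_left)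
          (fun i => (hf i).inter (hWm n)) hpf
    have hBU : B = ⋃ n, B ∩ W n := by rw [← Set.inter_iUnion, hWU, Set.inter_univ]
    rw [hBU]
    exact hunion _ (fun i j hij => (hWd hij).mono Set.inter_subset_right Set.inter_subset_right)
      (fun n => hB.inter (hWm n)) fun n => hpiece n B hB

/-- For a function with values in `ℕ ∪ {∞}`, measurability only has to be checked on the fibres of
the natural numbers. -/
theorem measurable_of_natCast_fibre {Ω : Type*} [MeasurableSpace Ω] {f : Ω → ℝ≥0∞}
    (hf : ∀ ω, ∃ n : ℕ∞, f ω = n) (hk : ∀ k : ℕ, MeasurableSet {ω | f ω = k}) :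
    Measurable f := by
  have hn : ∀ n : ℕ∞, MeasurableSet {ω | f ω = n} := by
    intro n
    induction n with
    | coe k => simpa using hk k
    | top =>
      have : {ω | f ω = ((⊤ : ℕ∞) : ℝ≥0∞)} = (⋃ k : ℕ, {ω | f ω = k})ᶜ := by
        ext ω
        simp only [Set.mem_ofPred_eq, Set.mem_compl_iff, Set.mem_iUnion, not_exists]
        obtain ⟨n, hn⟩ := hf ω
        rw [hn]
        induction n with
        | coe k => simp
        | top => simp
      rw [this]
      exact (MeasurableSet.iUnion hk).compl
  intro S _
  have : f ⁻¹' S = ⋃ (n : ℕ∞) (_ : (n : ℝ≥0∞) ∈ S), {ω | f ω = n} := by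
    ext ω
    simp only [Set.mem_preimage, Set.mem_iUnion, Set.mem_ofPred_eq, exists_prop]
    constructor
    · intro h
      obtain ⟨n, hn⟩ := hf ω
      exact ⟨n, hn ▸ h, hn⟩
    · rintro ⟨n, h1, h2⟩
      exact h2 ▸ h1
  rw [this]
  exact MeasurableSet.iUnion fun n => MeasurableSet.iUnion fun _ => hn n

/-- The event that the set `F p.1` has exactly `p.2` points, for every entry `p` of the list. -/
def countEvent {Ω Y ι : Type*} [MeasurableSpace Y] (η : Ω → Measure Y) (F : ι → Set Y)
    (l : List (ι × ℕ)) : Set Ω :=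
  {ω | ∀ p ∈ l, η ω (F p.1) = p.2}

section CountEvent

variable {Ω Y ι : Type*} {m : MeasurableSpace Ω}

theorem measurableSet_countEvent [MeasurableSpace Y] {η : Ω → Measure Y}
    {F : ι → Set Y} (hF : ∀ n, Measurable fun ω => η ω (F n)) (l : List (ι × ℕ)) :
    MeasurableSet (countEvent η F l) := by
  have : countEvent η F l = ⋂ p ∈ l, {ω | η ω (F p.1) = p.2} := by
    ext ω
    simp [countEvent]
  rw [this]
  exact MeasurableSet.biInter (l.finite_toSet.countable)
    fun p _ => hF p.1 (measurableSet_singleton _)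

/-- The indicator of a counting event is a Borel function of finitely many counts, and the same
function serves for all processes and all families of sets. -/
theorem exists_indicator_countEvent_eq [MeasurableSpace Y] (l : List (ι × ℕ)) :
    ∃ φ : (Fin l.length → ℝ≥0∞) → ℂ, Measurable φ ∧ ∀ (η : Ω → Measure Y) (F : ι → Set Y),
      (countEvent η F l).indicator (fun _ => (1 : ℂ)) =
        fun ω => φ fun i => η ω (F (l.get i).1) := by
  refine ⟨Set.indicator {x | ∀ i, x i = ((l.get i).2 : ℝ≥0∞)} fun _ => 1, ?_, fun η F => ?_⟩
  · refine measurable_const.indicator ?_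
    have : {x : Fin l.length → ℝ≥0∞ | ∀ i, x i = ((l.get i).2 : ℝ≥0∞)} =
        ⋂ i, {x | x i = ((l.get i).2 : ℝ≥0∞)} := by
      ext x
      simp
    rw [this]
    exact MeasurableSet.iInter fun i => measurable_pi_apply i (measurableSet_singleton _)
  · funext ω
    have : ω ∈ countEvent η F l ↔ (fun i => η ω (F (l.get i).1)) ∈
        {x : Fin l.length → ℝ≥0∞ | ∀ i, x i = ((l.get i).2 : ℝ≥0∞)} := List.forall_mem_iff_get
    by_cases h : ω ∈ countEvent η F l
    · rw [Set.indicator_of_mem h, Set.indicator_of_mem (this.1 h)]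
    · rw [Set.indicator_of_notMem h, Set.indicator_of_notMem (mt this.2 h)]

theorem isPiSystem_countEvent [MeasurableSpace Y] (η : Ω → Measure Y) (F : ι → Set Y) :
    IsPiSystem (Set.range (countEvent η F)) := by
  rintro _ ⟨l, rfl⟩ _ ⟨l', rfl⟩ _
  refine ⟨l ++ l', ?_⟩
  ext ω
  simp only [countEvent, List.mem_append, Set.mem_ofPred_eq, Set.mem_inter_iff]
  exact ⟨fun h => ⟨fun p hp => h p (.inl hp), fun p hp => h p (.inr hp)⟩,
    fun h p hp => hp.elim (h.1 p) (h.2 p)⟩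

variable [MeasurableSpace Ω] [MeasurableSpace Y] {μ : Measure Ω} {η : Ω → Measure Y}
  {lam : Measure Y}

theorem measurable_count_countAlgebra {L B : Set Y} (hB : MeasurableSet B) (hBL : B ⊆ L) :
    Measurable[countAlgebra μ η L] fun ω => η ω B := by
  have h : MeasurableSpace.comap (fun ω => η ω B) inferInstance ≤ countAlgebra μ η L :=
    (le_iSup (fun B : {B : Set Y // MeasurableSet B ∧ B ⊆ L} =>
      MeasurableSpace.comap (fun ω => η ω B.1) inferInstance) ⟨B, hB, hBL⟩).trans
      (@le_eventuallyMeasurableSpace Ω _ (ae μ) _)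
  exact measurable_iff_comap_le.2 h

theorem countAlgebra_le [μ.IsComplete] (hη : Measurable η) (L : Set Y) :
    countAlgebra μ η L ≤ ‹MeasurableSpace Ω› :=
  eventuallyMeasurableSpace_le <| iSup_le fun B =>
    measurable_iff_comap_le.1 ((Measure.measurable_coe B.2.1).comp hη)

theorem countAlgebra_le_of_measurable {L : Set Y}
    (h : ∀ B, MeasurableSet B → B ⊆ L →
      Measurable[@eventuallyMeasurableSpace Ω m (ae μ) inferInstance] fun ω => η ω B) :
    countAlgebra μ η L ≤ @eventuallyMeasurableSpace Ω m (ae μ) inferInstance :=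
  eventuallyMeasurableSpace_mono <| iSup_le fun B =>
    measurable_iff_comap_le.1 (h B.1 B.2.1 B.2.2)

theorem countAlgebra_mono {L L' : Set Y} (h : L ⊆ L') :
    countAlgebra μ η L ≤ countAlgebra μ η L' :=
  eventuallyMeasurableSpace_mono <| iSup_le fun B =>
    measurable_iff_comap_le.1 (measurable_count_countAlgebra B.2.1 (B.2.2.trans h))

/-- Up to null sets, the events that prescribe the counts of finitely many sets `A n ∩ R` generate
all the information about the process in `R`. -/
theorem IsPoissonProcess.countAlgebra_le_of_countEvent [IsProbabilityMeasure μ]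
    (hη : IsPoissonProcess μ η lam) {A : ℕ → Set Y} (hA : IsDynkinGenerating lam A) {R : Set Y}
    (hR : MeasurableSet R) (hm : ∀ l, MeasurableSet[m] (countEvent η (fun n => A n ∩ R) l)) :
    countAlgebra μ η R ≤ @eventuallyMeasurableSpace Ω m (ae μ) inferInstance := by
  suffices h : ∀ B, MeasurableSet B →
      Measurable[@eventuallyMeasurableSpace Ω m (ae μ) inferInstance] fun ω => η ω (B ∩ R) by
    refine countAlgebra_le_of_measurable fun B hB hBR => ?_
    simpa only [Set.inter_eq_left.2 hBR] using h B hB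
  refine hA.induction _ (fun n => ?_) (fun B C hB hC hBC hfin h1 h2 => ?_) fun f hd hf h => ?_
  · refine @measurable_of_natCast_fibre Ω (eventuallyMeasurableSpace m (ae μ)) _
      (fun ω => hη.integerValued ω _ ((hA.measurableSet n).inter hR)) fun k => ?_
    have hev : {ω | η ω (A n ∩ R) = k} = countEvent η (fun n => A n ∩ R) [(n, k)] := by
      ext ω
      simp [countEvent]
    rw [hev]
    exact MeasurableSet.eventuallyMeasurableSet (hm _)
  · -- the subtraction of counts is legitimate where the larger one is finite
    refine measurable_congr_eventuallyMeasurableSpace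
      (m0 := m) (μ := μ) (f := fun ω => η ω (C ∩ R) - η ω (B ∩ R)) ?_ ?_
    · exact @Measurable.sub _ _ _ _ _ (_) _ _ h2 h1
    · filter_upwards [hη.ae_count_lt_top hC hfin] with ω hω
      have : (C \ B) ∩ R = (C ∩ R) \ (B ∩ R) := by
        ext y
        simp only [Set.mem_inter_iff, Set.mem_sdiff]
        tauto
      rw [this, measure_sdiff (Set.inter_subset_inter_left _ hBC) (hB.inter hR).nullMeasurableSet]
      exact ((measure_mono (Set.inter_subset_left.trans hBC)).trans_lt hω).ne
  · have : (fun ω => η ω ((⋃ i, f i) ∩ R)) = fun ω => ∑' i, η ω (f i ∩ R) := by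
      funext ω
      rw [Set.iUnion_inter, measure_iUnion (fun i j hij =>
        (hd hij).mono Set.inter_subset_left Set.inter_subset_left) fun i => (hf i).inter hR]
    rw [this]
    exact @Measurable.tsum _ _ _ (eventuallyMeasurableSpace m (ae μ)) _ _ _ _ _ _ _ _ _ _ _ _ h

theorem IsDynkinGenerating.measurableSet_countEvent {A : ℕ → Set Y}
    (hA : IsDynkinGenerating lam A) {R : Set Y} (hR : MeasurableSet R) (l : List (ℕ × ℕ)) :
    MeasurableSet[countAlgebra μ η R] (countEvent η (fun n => A n ∩ R) l) :=
  _root_.measurableSet_countEvent (fun n =>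
    measurable_count_countAlgebra ((hA.measurableSet n).inter hR) Set.inter_subset_right) l

variable [IsProbabilityMeasure μ]

theorem IsPoissonProcess.eventVector_countEvent_mem [μ.IsComplete] (hη : IsPoissonProcess μ η lam)
    {A : ℕ → Set Y} (hA : IsDynkinGenerating lam A) {R : Set Y} (hR : MeasurableSet R)
    (l : List (ℕ × ℕ)) :
    eventVector μ (countEvent η (fun n => A n ∩ R) l) ∈ lpMeas ℂ ℂ (countAlgebra μ η R) 2 μ :=
  eventVector_mem_lpMeas (countAlgebra_le hη.measurable R)
    (hA.measurableSet_countEvent hR l)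

/-- The indicators of the events that prescribe the counts of finitely many sets `A n ∩ R` are
total in the space of square integrable functions of the process in `R`. -/
theorem IsPoissonProcess.mem_closure_span_countEvent (hη : IsPoissonProcess μ η lam)
    {A : ℕ → Set Y} (hA : IsDynkinGenerating lam A) {R : Set Y} (hR : MeasurableSet R)
    {f : Lp ℂ 2 μ} (hf : f ∈ lpMeas ℂ ℂ (countAlgebra μ η R) 2 μ) :
    f ∈ (Submodule.span ℂ (Set.range fun l =>
      eventVector μ (countEvent η (fun n => A n ∩ R) l))).topologicalClosure := by
  have hm : MeasurableSpace.generateFrom (Set.range (countEvent η fun n => A n ∩ R)) ≤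
      ‹MeasurableSpace Ω› := by
    refine MeasurableSpace.generateFrom_le ?_
    rintro _ ⟨l, rfl⟩
    exact measurableSet_countEvent
      (fun n => hη.measurable_count ((hA.measurableSet n).inter hR)) l
  have hV : ∀ l, eventVector μ (countEvent η (fun n => A n ∩ R) l) ∈
      (Submodule.span ℂ (Set.range fun l =>
        eventVector μ (countEvent η (fun n => A n ∩ R) l))).topologicalClosure :=
    fun l => Submodule.le_topologicalClosure _ (Submodule.subset_span ⟨l, rfl⟩)
  refine mem_of_eventVector_mem hm rfl (isPiSystem_countEvent η _)
    (Submodule.isClosed_topologicalClosure _) ?_ ?_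
    (aestronglyMeasurable_of_eventuallyMeasurableSpace
      ((mem_lpMeas_iff_aestronglyMeasurable.1 hf).mono
        (hη.countAlgebra_le_of_countEvent hA hR fun l =>
          MeasurableSpace.measurableSet_generateFrom ⟨l, rfl⟩)))
  · convert hV []
    simp [countEvent]
  · rintro _ ⟨l, rfl⟩
    exact hV l

/-- A Poisson process agrees almost surely with an `s`-finite kernel: on each of countably many
disjoint sets of finite intensity, the process is split according to its total number of points. -/
theorem IsPoissonProcess.exists_isSFiniteKernel (hη : IsPoissonProcess μ η lam) [SigmaFinite lam] :
    ∃ κ : Kernel Ω Y, IsSFiniteKernel κ ∧ ∀ᵐ ω ∂μ, κ ω = η ω := by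
  classical
  let W : ℕ → Set Y := disjointed (spanningSets lam)
  have hWm : ∀ n, MeasurableSet (W n) := MeasurableSet.disjointed (measurableSet_spanningSets lam)
  have hWfin : ∀ n, lam (W n) ≠ ∞ := fun n =>
    ((measure_mono (disjointed_subset _ n)).trans_lt (measure_spanningSets_lt_top lam n)).ne
  let K : Kernel Ω Y := ⟨η, hη.measurable⟩
  have hev : ∀ n k : ℕ, MeasurableSet {ω | η ω (W n) = k} := fun n k =>
    hη.measurable_count (hWm n) (measurableSet_singleton _)
  let κ : ℕ → ℕ → Kernel Ω Y := fun n k => Kernel.piecewise (hev n k) (K.restrict (hWm n)) 0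
  have hκ : ∀ n k, IsFiniteKernel (κ n k) := by
    intro n k
    refine ⟨k, ENNReal.natCast_lt_top k, fun ω => ?_⟩
    rw [Kernel.piecewise_apply]
    split_ifs with h
    · rw [Kernel.restrict_apply, Measure.restrict_apply_univ]
      exact le_of_eq h
    · simp
  refine ⟨Kernel.sum fun n => Kernel.sum (κ n), inferInstance, ?_⟩
  filter_upwards [ae_all_iff.2 fun n => hη.ae_count_lt_top (hWm n) (hWfin n)] with ω hω
  rw [Kernel.sum_apply, ← sum_restrict_disjointed_spanningSets (η ω) lam]
  congr 1
  funext n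
  obtain ⟨k, hk⟩ := hη.integerValued ω (W n) (hWm n)
  induction k with
  | top => exact absurd hk (by simpa using (hω n).ne)
  | coe k =>
    have hk' : η ω (W n) = k := by simpa using hk
    refine Measure.ext fun S hS => ?_
    rw [Kernel.sum_apply, Measure.sum_apply _ hS, tsum_eq_single k]
    · rw [Kernel.piecewise_apply, if_pos (show ω ∈ {ω | η ω (W n) = k} from hk')]
      rfl
    · intro j hj
      rw [Kernel.piecewise_apply, if_neg]
      · rfl
      · intro h
        have : (j : ℝ≥0∞) = k := Eq.trans (Eq.symm h) hk'
        exact hj (by exact_mod_cast this)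

/-- The counting events of a jointly measurable family of sets depend measurably, as vectors of
`L²`, on the parameter. -/
theorem IsPoissonProcess.measurable_eventVector_countEvent (hη : IsPoissonProcess μ η lam)
    [SigmaFinite lam] [SecondCountableTopology (Lp ℂ 2 μ)] [MeasurableSpace (Lp ℂ 2 μ)]
    [BorelSpace (Lp ℂ 2 μ)] {Z : Type*} [MeasurableSpace Z] {F : Z → ι → Set Y}
    (hF : ∀ n, MeasurableSet {x : Z × Y | x.2 ∈ F x.1 n}) (l : List (ι × ℕ)) :
    Measurable fun z => eventVector μ (countEvent η (F z) l) := by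
  obtain ⟨κ, _, hκ⟩ := hη.exists_isSFiniteKernel
  have hjoint : MeasurableSet {x : Z × Ω | x.2 ∈ countEvent κ (F x.1) l} := by
    have hcount : ∀ n, Measurable fun x : Z × Ω => κ x.2 (F x.1 n) := fun n =>
      Kernel.measurable_kernel_prodMk_left (κ := κ.comap Prod.snd measurable_snd)
        (t := {x : (Z × Ω) × Y | x.2 ∈ F x.1.1 n})
        ((measurable_fst.fst.prodMk measurable_snd) (hF n))
    have : {x : Z × Ω | x.2 ∈ countEvent κ (F x.1) l} =
        ⋂ p ∈ l, {x : Z × Ω | κ x.2 (F x.1 p.1) = p.2} := by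
      ext x
      simp [countEvent]
    rw [this]
    exact MeasurableSet.biInter (l.finite_toSet.countable)
      fun p _ => hcount p.1 (measurableSet_singleton _)
  have heq : ∀ z, eventVector μ (countEvent η (F z) l) = eventVector μ (countEvent κ (F z) l) := by
    intro z
    have hm : ∀ n, MeasurableSet (F z n) := fun n => measurable_prodMk_left (hF n)
    refine eventVector_congr (measurableSet_countEvent (fun n => hη.measurable_count (hm n)) l)
      (measurable_prodMk_left hjoint) ?_
    filter_upwards [hκ] with ω hω
    simp only [countEvent, eq_iff_iff]
    change (∀ p ∈ l, η ω (F z p.1) = p.2) ↔ ∀ p ∈ l, κ ω (F z p.1) = p.2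
    rw [hω]
  simp only [heq]
  exact measurable_eventVector hjoint

/-- The space of square integrable functions of the process is separable. -/
theorem IsPoissonProcess.secondCountableTopology_L2 [MeasurableSpace.CountablyGenerated Y]
    (hη : IsPoissonProcess μ η lam) [SigmaFinite lam]
    (hgen : ∀ A : Set Ω, MeasurableSet A → MeasurableSet[countAlgebra μ η Set.univ] A) :
    SecondCountableTopology (Lp ℂ 2 μ) := by
  obtain ⟨A, hA⟩ := exists_isDynkinGenerating lam
  have hsep : TopologicalSpace.SeparableSpace (Lp ℂ 2 μ) := by
    rw [← TopologicalSpace.isSeparable_univ_iff]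
    refine ((Set.countable_range fun l => eventVector μ
      (countEvent η (fun n => A n ∩ Set.univ) l)).isSeparable.span (R := ℂ)).closure.mono ?_
    intro f _
    refine hη.mem_closure_span_countEvent hA .univ ?_
    exact mem_lpMeas_iff_aestronglyMeasurable.2 ((Lp.aestronglyMeasurable f).mono hgen)
  exact UniformSpace.secondCountable_of_separable _

end CountEvent

/-! ### Products of independent square integrable functions -/

section Product

variable {Ω : Type*} [MeasurableSpace Ω] {μ : Measure Ω}

open Classical in
/-- The pointwise product of two elements of `L²`; the value is `0` when the product is not square
integrable. -/
def mulL2 (f g : Lp ℂ 2 μ) : Lp ℂ 2 μ :=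
  if h : MemLp (fun ω => f ω * g ω) 2 μ then h.toLp _ else 0

theorem mulL2_coeFn {f g : Lp ℂ 2 μ} (h : MemLp (fun ω => f ω * g ω) 2 μ) :
    (mulL2 f g : Ω → ℂ) =ᵐ[μ] fun ω => f ω * g ω := by
  rw [mulL2, dif_pos h]
  exact h.coeFn_toLp

theorem mulL2_eq {f g k : Lp ℂ 2 μ} (h : (k : Ω → ℂ) =ᵐ[μ] fun ω => f ω * g ω) :
    mulL2 f g = k := by
  have hm : MemLp (fun ω => f ω * g ω) 2 μ := (memLp_congr_ae h).1 (Lp.memLp k)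
  exact Lp.ext ((mulL2_coeFn hm).trans h.symm)

/-- Pointwise multiplication as a bilinear map on a pair of subspaces whose products are square
integrable. -/
def mulL2Bilin (V W : Submodule ℂ (Lp ℂ 2 μ))
    (h : ∀ f ∈ V, ∀ g ∈ W, MemLp (fun ω => f ω * g ω) 2 μ) : V →ₗ[ℂ] W →ₗ[ℂ] Lp ℂ 2 μ :=
  LinearMap.mk₂ ℂ (fun f g => mulL2 f.1 g.1)
    (fun f f' g => mulL2_eq <| by
      filter_upwards [Lp.coeFn_add (mulL2 f.1 g.1) (mulL2 f'.1 g.1), Lp.coeFn_add f.1 f'.1,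
        mulL2_coeFn (h f.1 f.2 g.1 g.2), mulL2_coeFn (h f'.1 f'.2 g.1 g.2)] with ω h1 h2 h3 h4
      rw [h1, Pi.add_apply, h3, h4, Submodule.coe_add, h2, Pi.add_apply, add_mul])
    (fun c f g => mulL2_eq <| by
      filter_upwards [Lp.coeFn_smul c (mulL2 f.1 g.1), Lp.coeFn_smul c f.1,
        mulL2_coeFn (h f.1 f.2 g.1 g.2)] with ω h1 h2 h3
      rw [h1, Pi.smul_apply, h3, Submodule.coe_smul, h2, Pi.smul_apply, smul_mul_assoc])
    (fun f g g' => mulL2_eq <| by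
      filter_upwards [Lp.coeFn_add (mulL2 f.1 g.1) (mulL2 f.1 g'.1), Lp.coeFn_add g.1 g'.1,
        mulL2_coeFn (h f.1 f.2 g.1 g.2), mulL2_coeFn (h f.1 f.2 g'.1 g'.2)] with ω h1 h2 h3 h4
      rw [h1, Pi.add_apply, h3, h4, Submodule.coe_add, h2, Pi.add_apply, mul_add])
    (fun c f g => mulL2_eq <| by
      filter_upwards [Lp.coeFn_smul c (mulL2 f.1 g.1), Lp.coeFn_smul c g.1,
        mulL2_coeFn (h f.1 f.2 g.1 g.2)] with ω h1 h2 h3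
      rw [h1, Pi.smul_apply, h3, Submodule.coe_smul, h2, Pi.smul_apply, mul_smul_comm])

theorem mulL2_eventVector [IsFiniteMeasure μ] {s t : Set Ω} (hs : MeasurableSet s)
    (ht : MeasurableSet t) :
    mulL2 (eventVector μ s) (eventVector μ t) = eventVector μ (s ∩ t) := by
  refine mulL2_eq ?_
  filter_upwards [eventVector_coeFn (μ := μ) hs, eventVector_coeFn (μ := μ) ht,
    eventVector_coeFn (μ := μ) (hs.inter ht)] with ω h1 h2 h3
  rw [h1, h2, h3]
  by_cases h4 : ω ∈ s <;> by_cases h5 : ω ∈ t <;> simp [h4, h5]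

theorem memLp_two_mul_of_indepFun {f g : Lp ℂ 2 μ} (h : IndepFun f g μ) :
    MemLp (fun ω => f ω * g ω) 2 μ := by
  have hm : AEStronglyMeasurable (fun ω => f ω * g ω) μ :=
    (Lp.aestronglyMeasurable f).mul (Lp.aestronglyMeasurable g)
  refine (memLp_two_iff_integrable_sq_norm hm).2 ?_
  have hf := (memLp_two_iff_integrable_sq_norm (Lp.aestronglyMeasurable f)).1 (Lp.memLp f)
  have hg := (memLp_two_iff_integrable_sq_norm (Lp.aestronglyMeasurable g)).1 (Lp.memLp g)
  have hsq : Measurable fun z : ℂ => ‖z‖ ^ 2 := by fun_prop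
  simp only [norm_mul, mul_pow]
  exact (h.comp hsq hsq).integrable_mul hf hg

theorem inner_mulL2_of_indepFun {f f' g g' : Lp ℂ 2 μ}
    (h : IndepFun (fun ω => (f ω, f' ω)) (fun ω => (g ω, g' ω)) μ) :
    ⟪mulL2 f g, mulL2 f' g'⟫_ℂ = ⟪f, f'⟫_ℂ * ⟪g, g'⟫_ℂ := by
  have h1 : IndepFun f g μ := h.comp measurable_fst measurable_fst
  have h2 : IndepFun f' g' μ := h.comp measurable_snd measurable_snd
  have hi : Measurable fun z : ℂ × ℂ => ⟪z.1, z.2⟫_ℂ := by fun_prop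
  rw [L2.inner_def, L2.inner_def, L2.inner_def]
  have hmul := (h.comp hi hi).integral_fun_mul_eq_mul_integral
    ((Lp.aestronglyMeasurable f).inner (Lp.aestronglyMeasurable f'))
    ((Lp.aestronglyMeasurable g).inner (Lp.aestronglyMeasurable g'))
  refine Eq.trans (integral_congr_ae ?_) hmul
  filter_upwards [mulL2_coeFn (memLp_two_mul_of_indepFun h1),
    mulL2_coeFn (memLp_two_mul_of_indepFun h2)] with ω e1 e2
  rw [e1, e2]
  simp only [RCLike.inner_apply, Function.comp_apply, map_mul]
  ring

end Product

/-! ### The shift on the space of square integrable functions of the process -/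

section Shift

variable {Ω Y G : Type*} [MeasurableSpace Ω] [MeasurableSpace Y] {μ : Measure Ω}
  {η : Ω → Measure Y} {lam : Measure Y}

/-- Every square integrable function of the process in `L` is a function of the counts of the
measurable subsets of `L`. -/
theorem exists_eq_comp_counts {L : Set Y} {f : Lp ℂ 2 μ}
    (hf : f ∈ lpMeas ℂ ℂ (countAlgebra μ η L) 2 μ) :
    ∃ φ : ({B : Set Y // MeasurableSet B ∧ B ⊆ L} → ℝ≥0∞) → ℂ, Measurable φ ∧
      (f : Ω → ℂ) =ᵐ[μ] fun ω => φ fun B => η ω B.1 := by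
  obtain ⟨g, hg, hfg⟩ := aestronglyMeasurable_of_eventuallyMeasurableSpace
    (mem_lpMeas_iff_aestronglyMeasurable.1 hf)
  have hcomap : (⨆ B : {B : Set Y // MeasurableSet B ∧ B ⊆ L},
      MeasurableSpace.comap (fun ω => η ω B.1) inferInstance) = MeasurableSpace.comap
        (fun ω (B : {B : Set Y // MeasurableSet B ∧ B ⊆ L}) => η ω B.1) MeasurableSpace.pi := by
    rw [MeasurableSpace.pi, MeasurableSpace.comap_iSup]
    simp only [MeasurableSpace.comap_comp]
    rfl
  rw [hcomap] at hg
  obtain ⟨φ, hφ, rfl⟩ := hg.measurable.exists_eq_measurable_comp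
  exact ⟨φ, hφ, hfg⟩

theorem mem_lpMeas_of_eq_comp_counts {L : Set Y} {f : Lp ℂ 2 μ} {κ : Type*} {B : κ → Set Y}
    (hB : ∀ k, MeasurableSet (B k)) (hBL : ∀ k, B k ⊆ L) {φ : (κ → ℝ≥0∞) → ℂ}
    (hφ : Measurable φ) (hf : (f : Ω → ℂ) =ᵐ[μ] fun ω => φ fun k => η ω (B k)) :
    f ∈ lpMeas ℂ ℂ (countAlgebra μ η L) 2 μ := by
  refine mem_lpMeas_iff_aestronglyMeasurable.2 ⟨_, Measurable.stronglyMeasurable ?_, hf⟩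
  exact hφ.comp (@measurable_pi_lambda _ _ _ (countAlgebra μ η L) _ _
    fun k => measurable_count_countAlgebra (hB k) (hBL k))

/-- Functions of the process in disjoint sets are independent. -/
theorem IsPoissonProcess.indepFun_lpMeas [IsProbabilityMeasure μ] (hη : IsPoissonProcess μ η lam)
    {L L' : Set Y} (hd : Disjoint L L') {f f' g g' : Lp ℂ 2 μ}
    (hf : f ∈ lpMeas ℂ ℂ (countAlgebra μ η L) 2 μ) (hf' : f' ∈ lpMeas ℂ ℂ (countAlgebra μ η L) 2 μ)
    (hg : g ∈ lpMeas ℂ ℂ (countAlgebra μ η L') 2 μ)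
    (hg' : g' ∈ lpMeas ℂ ℂ (countAlgebra μ η L') 2 μ) :
    IndepFun (fun ω => (f ω, f' ω)) (fun ω => (g ω, g' ω)) μ := by
  obtain ⟨φ, hφ, ef⟩ := exists_eq_comp_counts hf
  obtain ⟨φ', hφ', ef'⟩ := exists_eq_comp_counts hf'
  obtain ⟨ψ, hψ, eg⟩ := exists_eq_comp_counts hg
  obtain ⟨ψ', hψ', eg'⟩ := exists_eq_comp_counts hg'
  have h := hη.indepFun_counts (B := fun B : {B : Set Y // MeasurableSet B ∧ B ⊆ L} => B.1)
    (C := fun B : {B : Set Y // MeasurableSet B ∧ B ⊆ L'} => B.1) (fun B => B.2.1)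
    (fun B => B.2.1) fun B C => hd.mono B.2.2 C.2.2
  refine (h.comp (hφ.prodMk hφ') (hψ.prodMk hψ')).congr ?_ ?_
  · filter_upwards [ef, ef'] with ω h1 h2
    rw [h1, h2]
    rfl
  · filter_upwards [eg, eg'] with ω h1 h2
    rw [h1, h2]
    rfl

variable [AddGroup G] [AddAction G Y]

/-- The isometry `U` of `L²` is the shift by `c`: it moves the sets in every function of the counts
of the process. -/
def IsCountShift (μ : Measure Ω) (η : Ω → Measure Y) (c : G) (U : Lp ℂ 2 μ →ₗᵢ[ℂ] Lp ℂ 2 μ) :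
    Prop :=
  ∀ φ : ({B : Set Y // MeasurableSet B} → ℝ≥0∞) → ℂ, Measurable φ → ∀ f : Lp ℂ 2 μ,
    (f : Ω → ℂ) =ᵐ[μ] (fun ω => φ fun B => η ω B.1) →
    (U f : Ω → ℂ) =ᵐ[μ] fun ω => φ fun B => η ω (c +ᵥ B.1)

theorem IsCountShift.coeFn {c : G} {U : Lp ℂ 2 μ →ₗᵢ[ℂ] Lp ℂ 2 μ} (hU : IsCountShift μ η c U)
    {κ : Type*} {B : κ → Set Y} (hB : ∀ k, MeasurableSet (B k)) {φ : (κ → ℝ≥0∞) → ℂ}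
    (hφ : Measurable φ) {f : Lp ℂ 2 μ} (hf : (f : Ω → ℂ) =ᵐ[μ] fun ω => φ fun k => η ω (B k)) :
    (U f : Ω → ℂ) =ᵐ[μ] fun ω => φ fun k => η ω (c +ᵥ B k) :=
  hU (fun x => φ fun k => x ⟨B k, hB k⟩)
    (hφ.comp (measurable_pi_lambda _ fun _ => measurable_pi_apply _)) f hf

/-- The shift is multiplicative. -/
theorem IsCountShift.coeFn_mul
    (hgen : ∀ A : Set Ω, MeasurableSet A → MeasurableSet[countAlgebra μ η Set.univ] A)
    {c : G} {U : Lp ℂ 2 μ →ₗᵢ[ℂ] Lp ℂ 2 μ} (hU : IsCountShift μ η c U) {f g k : Lp ℂ 2 μ}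
    (h : (k : Ω → ℂ) =ᵐ[μ] fun ω => f ω * g ω) :
    (U k : Ω → ℂ) =ᵐ[μ] fun ω => U f ω * U g ω := by
  have hmem : ∀ f : Lp ℂ 2 μ, f ∈ lpMeas ℂ ℂ (countAlgebra μ η Set.univ) 2 μ := fun f =>
    mem_lpMeas_iff_aestronglyMeasurable.2 ((Lp.aestronglyMeasurable f).mono hgen)
  obtain ⟨φ, hφ, ef⟩ := exists_eq_comp_counts (hmem f)
  obtain ⟨ψ, hψ, eg⟩ := exists_eq_comp_counts (hmem g)
  have ek : (k : Ω → ℂ) =ᵐ[μ] fun ω => (φ * ψ) fun B => η ω B.1 := by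
    filter_upwards [h, ef, eg] with ω h1 h2 h3
    rw [h1, h2, h3]
    rfl
  filter_upwards [hU.coeFn (fun B => B.2.1) hφ ef, hU.coeFn (fun B => B.2.1) hψ eg,
    hU.coeFn (fun B => B.2.1) (hφ.mul hψ) ek] with ω h1 h2 h3
  rw [h1, h2, h3]
  rfl

variable [MeasurableConstVAdd G Y]

/-- Invariance of the intensity measure makes the process stationary. -/
theorem IsPoissonProcess.map_counts_vadd [IsProbabilityMeasure μ] [VAddInvariantMeasure G Y lam]
    (hη : IsPoissonProcess μ η lam) (c : G) {κ : Type*} {B : κ → Set Y}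
    (hB : ∀ k, MeasurableSet (B k)) :
    μ.map (fun ω k => η ω (c +ᵥ B k)) = μ.map fun ω k => η ω (B k) := by
  have hm : Measurable fun ω k => η ω (B k) :=
    measurable_pi_lambda _ fun k => hη.measurable_count (hB k)
  have hmc : Measurable fun ω k => η ω (c +ᵥ B k) :=
    measurable_pi_lambda _ fun k => hη.measurable_count ((hB k).const_vadd c)
  have hP := Measure.isProbabilityMeasure_map (μ := μ) hm.aemeasurable
  -- a law on a product space is determined by its finite-dimensional marginals
  refine IsProjectiveLimit.unique
    (P := fun I => (μ.map fun ω k => η ω (B k)).map I.restrict) (fun I => ?_) fun I => rfl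
  change (μ.map fun ω k => η ω (c +ᵥ B k)).map I.restrict =
    (μ.map fun ω k => η ω (B k)).map I.restrict
  rw [Measure.map_map (by fun_prop) hmc, Measure.map_map (by fun_prop) hm]
  refine hη.map_counts_eq (B := fun k : I => c +ᵥ B k) (B' := fun k : I => B k)
    (fun k => (hB k).const_vadd c) (fun k => hB k) fun s => ?_
  have : atom (fun k : I => c +ᵥ B k) s = c +ᵥ atom (fun k : I => B k) s := by
    ext y
    simp only [atom, Set.mem_vadd_set_iff_neg_vadd_mem, Set.mem_ofPred_eq]
  rw [this, measure_vadd]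

/-- Both the process and the shifted process give isometric copies, inside `L²` of the probability
space, of `L²` of their common law. As the process generates the `σ`-algebra, the first of these
copies is the whole space, and the shift is the composition of one embedding with the inverse of
the other. -/
theorem IsPoissonProcess.exists_isCountShift [IsProbabilityMeasure μ]
    [VAddInvariantMeasure G Y lam] (hη : IsPoissonProcess μ η lam)
    (hgen : ∀ A : Set Ω, MeasurableSet A → MeasurableSet[countAlgebra μ η Set.univ] A) (c : G) :
    ∃ U : Lp ℂ 2 μ →ₗᵢ[ℂ] Lp ℂ 2 μ, IsCountShift μ η c U := by
  let N : Ω → {B : Set Y // MeasurableSet B} → ℝ≥0∞ := fun ω B => η ω B.1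
  let Nc : Ω → {B : Set Y // MeasurableSet B} → ℝ≥0∞ := fun ω B => η ω (c +ᵥ B.1)
  have hN : MeasurePreserving N μ (μ.map N) :=
    ⟨measurable_pi_lambda _ fun B => hη.measurable_count B.2, rfl⟩
  have hNc : MeasurePreserving Nc μ (μ.map N) :=
    ⟨measurable_pi_lambda _ fun B => hη.measurable_count (B.2.const_vadd c),
      hη.map_counts_vadd c fun B : {B : Set Y // MeasurableSet B} => B.2⟩
  let V : Lp ℂ 2 (μ.map N) →ₗᵢ[ℂ] Lp ℂ 2 μ := Lp.compMeasurePreservingₗᵢ ℂ N hN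
  let Vc : Lp ℂ 2 (μ.map N) →ₗᵢ[ℂ] Lp ℂ 2 μ := Lp.compMeasurePreservingₗᵢ ℂ Nc hNc
  have hrep : ∀ φ : ({B : Set Y // MeasurableSet B} → ℝ≥0∞) → ℂ, Measurable φ → ∀ f : Lp ℂ 2 μ,
      (f : Ω → ℂ) =ᵐ[μ] φ ∘ N → ∃ g, V g = f ∧ (Vc g : Ω → ℂ) =ᵐ[μ] φ ∘ Nc := by
    intro φ hφ f hf
    have hφm : MemLp φ 2 (μ.map N) :=
      (memLp_map_measure_iff hφ.aestronglyMeasurable hN.measurable.aemeasurable).2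
        ((memLp_congr_ae hf).1 (Lp.memLp f))
    refine ⟨hφm.toLp φ, Lp.ext ?_, ?_⟩
    · have h1 : V (hφm.toLp φ) = (hφm.comp_measurePreserving hN).toLp _ :=
        Lp.toLp_compMeasurePreserving hφm hN
      rw [h1]
      exact (MemLp.coeFn_toLp _).trans hf.symm
    · have h1 : Vc (hφm.toLp φ) = (hφm.comp_measurePreserving hNc).toLp _ :=
        Lp.toLp_compMeasurePreserving hφm hNc
      rw [h1]
      exact MemLp.coeFn_toLp _
  have hsurj : Function.Surjective V := by
    intro f
    obtain ⟨φ, hφ, hf⟩ := exists_eq_comp_counts (η := η) (L := Set.univ)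
      (mem_lpMeas_iff_aestronglyMeasurable.2 ((Lp.aestronglyMeasurable f).mono hgen))
    obtain ⟨g, hg, _⟩ := hrep (fun x => φ fun B => x ⟨B.1, B.2.1⟩)
      (hφ.comp (measurable_pi_lambda _ fun _ => measurable_pi_apply _)) f hf
    exact ⟨g, hg⟩
  refine ⟨Vc.comp (LinearIsometryEquiv.ofSurjective V hsurj).symm.toLinearIsometry,
    fun φ hφ f hf => ?_⟩
  obtain ⟨g, rfl, hg⟩ := hrep φ hφ f hf
  have : (LinearIsometryEquiv.ofSurjective V hsurj).symm (V g) = g :=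
    (LinearIsometryEquiv.ofSurjective V hsurj).symm_apply_apply g
  simp only [LinearIsometry.coe_comp, Function.comp_apply, LinearIsometryEquiv.coe_toLinearIsometry,
    this]
  exact hg

namespace IsCountShift

theorem mem_lpMeas {c : G} {U : Lp ℂ 2 μ →ₗᵢ[ℂ] Lp ℂ 2 μ} (hU : IsCountShift μ η c U) {L : Set Y}
    {f : Lp ℂ 2 μ} (hf : f ∈ lpMeas ℂ ℂ (countAlgebra μ η L) 2 μ) :
    U f ∈ lpMeas ℂ ℂ (countAlgebra μ η (c +ᵥ L)) 2 μ := by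
  obtain ⟨φ, hφ, ef⟩ := exists_eq_comp_counts hf
  exact mem_lpMeas_of_eq_comp_counts
    (B := fun B : {B : Set Y // MeasurableSet B ∧ B ⊆ L} => c +ᵥ B.1)
    (fun B => B.2.1.const_vadd c) (fun B => Set.vadd_set_mono B.2.2) hφ
    (hU.coeFn (B := fun B : {B : Set Y // MeasurableSet B ∧ B ⊆ L} => B.1) (fun B => B.2.1) hφ ef)

theorem eventVector_countEvent [IsFiniteMeasure μ] (hη : IsPoissonProcess μ η lam) {c : G}
    {U : Lp ℂ 2 μ →ₗᵢ[ℂ] Lp ℂ 2 μ} (hU : IsCountShift μ η c U) {ι : Type*} {F : ι → Set Y}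
    (hF : ∀ n, MeasurableSet (F n)) (l : List (ι × ℕ)) :
    U (eventVector μ (countEvent η F l)) = eventVector μ (countEvent η (fun n => c +ᵥ F n) l) := by
  obtain ⟨φ, hφ, hev⟩ := exists_indicator_countEvent_eq (Ω := Ω) (Y := Y) l
  have h0 := eventVector_coeFn (μ := μ)
    (measurableSet_countEvent (fun n => hη.measurable_count (hF n)) l)
  have h1 := eventVector_coeFn (μ := μ)
    (measurableSet_countEvent (fun n => hη.measurable_count ((hF n).const_vadd c)) l)
  rw [hev] at h0 h1
  exact Lp.ext ((hU.coeFn (fun i => hF _) hφ h0).trans h1.symm)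

theorem comp_apply
    (hgen : ∀ A : Set Ω, MeasurableSet A → MeasurableSet[countAlgebra μ η Set.univ] A)
    {c c' c'' : G} {U U' U'' : Lp ℂ 2 μ →ₗᵢ[ℂ] Lp ℂ 2 μ} (hU : IsCountShift μ η c U)
    (hU' : IsCountShift μ η c' U') (hU'' : IsCountShift μ η c'' U'') (hc : c + c' = c'')
    (f : Lp ℂ 2 μ) : U (U' f) = U'' f := by
  have hmem : f ∈ lpMeas ℂ ℂ (countAlgebra μ η Set.univ) 2 μ :=
    mem_lpMeas_iff_aestronglyMeasurable.2 ((Lp.aestronglyMeasurable f).mono hgen)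
  obtain ⟨φ, hφ, ef⟩ := exists_eq_comp_counts hmem
  refine Lp.ext ?_
  have h1 := hU.coeFn (fun B => B.2.1.const_vadd c') hφ (hU'.coeFn (fun B => B.2.1) hφ ef)
  have h2 := hU''.coeFn (fun B => B.2.1) hφ ef
  filter_upwards [h1, h2] with ω e1 e2
  rw [e1, e2, ← hc]
  simp only [vadd_vadd]

theorem apply_zero
    (hgen : ∀ A : Set Ω, MeasurableSet A → MeasurableSet[countAlgebra μ η Set.univ] A)
    {U : Lp ℂ 2 μ →ₗᵢ[ℂ] Lp ℂ 2 μ} (hU : IsCountShift μ η (0 : G) U) (f : Lp ℂ 2 μ) : U f = f :=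
  U.injective (hU.comp_apply hgen hU hU (add_zero 0) f)

end IsCountShift

end Shift

/-! ### The regions of a cone and the shifts between them -/

section Region

variable {d : ℕ} {P : PointedCone ℝ (EuclideanSpace ℝ (Fin d))} {Y : Type*}
  [AddAction (EuclideanSpace ℝ (Fin d)) Y] {X : Set Y}

theorem vadd_region (c a b : P) :
    (c : EuclideanSpace ℝ (Fin d)) +ᵥ region P X a b = region P X (a + c) (b + c) := by
  simp only [region, Set.vadd_set_sdiff, vadd_vadd, Submodule.coe_add, add_comm]

theorem vadd_region_zero (a b : P) :
    (a : EuclideanSpace ℝ (Fin d)) +ᵥ region P X 0 b = region P X (0 + a) (b + a) :=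
  vadd_region a 0 b

theorem vadd_subset_of_invariant (hX : ∀ a ∈ P, ∀ x ∈ X, a +ᵥ x ∈ X) (a b : P) :
    ((a + b : P) : EuclideanSpace ℝ (Fin d)) +ᵥ X ⊆ (a : EuclideanSpace ℝ (Fin d)) +ᵥ X := by
  rw [Submodule.coe_add, ← vadd_vadd]
  refine Set.vadd_set_mono ?_
  rintro _ ⟨x, hx, rfl⟩
  exact hX b b.2 x hx

theorem region_subset_left (hX : ∀ a ∈ P, ∀ x ∈ X, a +ᵥ x ∈ X) (a b : P) :
    region P X 0 a ⊆ region P X 0 (a + b) :=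
  Set.sdiff_subset_sdiff_right (vadd_subset_of_invariant hX a b)

theorem region_subset_right (hX : ∀ a ∈ P, ∀ x ∈ X, a +ᵥ x ∈ X) (a b : P) :
    region P X (0 + a) (b + a) ⊆ region P X 0 (a + b) := by
  rw [add_comm b a]
  exact Set.sdiff_subset_sdiff_left (vadd_subset_of_invariant hX 0 a)

theorem disjoint_region (a b : P) : Disjoint (region P X 0 a) (region P X (0 + a) (b + a)) := by
  rw [zero_add]
  exact Set.disjoint_left.2 fun y h1 h2 => h1.2 h2.1

theorem region_subset_union (a b : P) :
    region P X 0 (a + b) ⊆ region P X 0 a ∪ region P X (0 + a) (b + a) := by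
  rw [zero_add, add_comm b a]
  rintro y ⟨h1, h2⟩
  by_cases h : y ∈ (a : EuclideanSpace ℝ (Fin d)) +ᵥ X
  · exact .inr ⟨h, h2⟩
  · exact .inl ⟨h1, h⟩

theorem region_self (a : P) : region P X a a = ∅ := Set.sdiff_self

variable [MeasurableSpace Y] [MeasurableVAdd₂ (EuclideanSpace ℝ (Fin d)) Y]

theorem measurableSet_region (hX : MeasurableSet X) (a b : P) : MeasurableSet (region P X a b) :=
  (hX.const_vadd _).diff (hX.const_vadd _)

/-- Translates of jointly measurable families of sets are jointly measurable. -/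
theorem measurableSet_vadd_family {Z : Type*} [MeasurableSpace Z]
    {c : Z → EuclideanSpace ℝ (Fin d)} (hc : Measurable c) {B : Z → Set Y}
    (hB : MeasurableSet {x : Z × Y | x.2 ∈ B x.1}) :
    MeasurableSet {x : Z × Y | x.2 ∈ c x.1 +ᵥ B x.1} := by
  simp only [Set.mem_vadd_set_iff_neg_vadd_mem]
  have h : Measurable fun x : Z × Y => (x.1, -c x.1 +ᵥ x.2) :=
    measurable_fst.prodMk ((hc.comp measurable_fst).neg.vadd measurable_snd)
  exact h hB

theorem measurableSet_region_family (hX : MeasurableSet X) {Z : Type*} [MeasurableSpace Z]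
    {a : Z → P} (ha : Measurable a) :
    MeasurableSet {x : Z × Y | x.2 ∈ region P X 0 (a x.1)} := by
  have h : MeasurableSet {x : Z × Y | x.2 ∈ X} := measurable_snd hX
  have h0 := measurableSet_vadd_family (c := fun _ : Z => ((0 : P) : EuclideanSpace ℝ (Fin d)))
    measurable_const (B := fun _ => X) h
  have ha := measurableSet_vadd_family (measurable_subtype_coe.comp ha)
    (B := fun _ => X) h
  exact h0.diff ha

end Region

section PoissonShift

variable {d : ℕ} {P : PointedCone ℝ (EuclideanSpace ℝ (Fin d))} {Ω Y : Type*} [MeasurableSpace Ω]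
  [MeasurableSpace Y] [AddAction (EuclideanSpace ℝ (Fin d)) Y] {μ : Measure Ω}
  {η : Ω → Measure Y} {lam : Measure Y} {X : Set Y}

theorem IsCountShift.isShift {c a b : P} {U : Lp ℂ 2 μ →ₗᵢ[ℂ] Lp ℂ 2 μ}
    (hU : IsCountShift μ η (c : EuclideanSpace ℝ (Fin d)) U)
    {S : regionL2 P μ η X a b ≃ₗᵢ[ℂ] regionL2 P μ η X (a + c) (b + c)}
    (hS : ∀ f, (S f : Lp ℂ 2 μ) = U f) : IsShift P μ η X c a b S := by
  intro n B hB _ φ hφ f hf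
  rw [hS]
  exact hU.coeFn hB hφ hf

variable [MeasurableVAdd₂ (EuclideanSpace ℝ (Fin d)) Y]

/-- The shift is determined by its values on the functions of finitely many counts. -/
theorem IsCountShift.eq_of_isShift [IsProbabilityMeasure μ] [μ.IsComplete]
    [MeasurableSpace.CountablyGenerated Y] [SigmaFinite lam]
    (hη : IsPoissonProcess μ η lam) (hX : MeasurableSet X) {c a b : P}
    {U : Lp ℂ 2 μ →ₗᵢ[ℂ] Lp ℂ 2 μ} (hU : IsCountShift μ η (c : EuclideanSpace ℝ (Fin d)) U)
    {S : regionL2 P μ η X a b ≃ₗᵢ[ℂ] regionL2 P μ η X (a + c) (b + c)}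
    (hS : IsShift P μ η X c a b S) (f : regionL2 P μ η X a b) : (S f : Lp ℂ 2 μ) = U f := by
  obtain ⟨A, hA⟩ := exists_isDynkinGenerating lam
  have hR := measurableSet_region (P := P) hX a b
  obtain ⟨v, hv⟩ : ∃ v : List (ℕ × ℕ) → regionL2 P μ η X a b, ∀ l,
      (v l : Lp ℂ 2 μ) = eventVector μ (countEvent η (fun n => A n ∩ region P X a b) l) :=
    ⟨fun l => ⟨_, hη.eventVector_countEvent_mem hA hR l⟩, fun _ => rfl⟩
  have hgen : ∀ l, (S (v l) : Lp ℂ 2 μ) = U (v l) := by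
    intro l
    have hB : ∀ n, MeasurableSet (A n ∩ region P X a b) := fun n =>
      (hA.measurableSet n).inter hR
    obtain ⟨φ, hφ, hev⟩ := exists_indicator_countEvent_eq (Ω := Ω) (Y := Y) l
    have he := eventVector_coeFn (μ := μ) (measurableSet_countEvent (η := η)
      (fun n => hη.measurable_count (hB n)) l)
    rw [hev, ← hv] at he
    refine Lp.ext ?_
    exact (hS _ _ (fun i => hB (l.get i).1) (fun i => Set.inter_subset_right) φ hφ _ he).trans
      (hU.coeFn (fun i => hB (l.get i).1) hφ he).symm
  have hcl : IsClosed {f : regionL2 P μ η X a b | (S f : Lp ℂ 2 μ) = U f} :=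
    isClosed_eq (continuous_subtype_val.comp S.continuous)
      (U.continuous.comp continuous_subtype_val)
  have hdense : Dense (Submodule.span ℂ (Set.range v) : Set (regionL2 P μ η X a b)) := by
    refine dense_span_range_of_subset_closure fun f hf => ?_
    simp only [hv]
    exact hη.mem_closure_span_countEvent hA hR hf
  have hsub : (Submodule.span ℂ (Set.range v) : Set (regionL2 P μ η X a b)) ⊆
      {f | (S f : Lp ℂ 2 μ) = U f} := by
    intro f hf
    refine LinearMap.eqOn_span (f := (regionL2 P μ η X (a + c) (b + c)).subtype ∘ₗ
      S.toLinearEquiv.toLinearMap) (g := U.toLinearMap ∘ₗ (regionL2 P μ η X a b).subtype) ?_ hf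
    rintro _ ⟨l, rfl⟩
    exact hgen l
  exact closure_minimal hsub hcl (hdense f)

theorem exists_mem_lpMeas_shift_eq
    (hgen : ∀ A : Set Ω, MeasurableSet A → MeasurableSet[countAlgebra μ η Set.univ] A)
    {U : EuclideanSpace ℝ (Fin d) → Lp ℂ 2 μ →ₗᵢ[ℂ] Lp ℂ 2 μ}
    (hU : ∀ c, IsCountShift μ η c (U c)) (c : EuclideanSpace ℝ (Fin d)) {L : Set Y} {f : Lp ℂ 2 μ}
    (hf : f ∈ lpMeas ℂ ℂ (countAlgebra μ η (c +ᵥ L)) 2 μ) :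
    ∃ g ∈ lpMeas ℂ ℂ (countAlgebra μ η L) 2 μ, U c g = f := by
  refine ⟨U (-c) f, ?_, ?_⟩
  · simpa only [neg_vadd_vadd] using (hU (-c)).mem_lpMeas hf
  · rw [(hU c).comp_apply hgen (hU (-c)) (hU 0) (add_neg_cancel c), (hU 0).apply_zero hgen]

theorem exists_isShift
    (hgen : ∀ A : Set Ω, MeasurableSet A → MeasurableSet[countAlgebra μ η Set.univ] A)
    {U : EuclideanSpace ℝ (Fin d) → Lp ℂ 2 μ →ₗᵢ[ℂ] Lp ℂ 2 μ}
    (hU : ∀ c, IsCountShift μ η c (U c)) (c a b : P) :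
    ∃ S : regionL2 P μ η X a b ≃ₗᵢ[ℂ] regionL2 P μ η X (a + c) (b + c),
      IsShift P μ η X c a b S := by
  have hmaps : ∀ f ∈ regionL2 P μ η X a b, U c f ∈ regionL2 P μ η X (a + c) (b + c) := by
    intro f hf
    have := (hU c).mem_lpMeas hf
    rwa [vadd_region] at this
  let T : regionL2 P μ η X a b →ₗᵢ[ℂ] regionL2 P μ η X (a + c) (b + c) :=
    { toLinearMap := (U c).toLinearMap.restrict hmaps
      norm_map' := fun f => (U c).norm_map f }
  have hT : Function.Surjective T := by
    rintro ⟨f, hf⟩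
    have hf' := hf
    rw [regionL2, ← vadd_region] at hf'
    obtain ⟨g, hg, rfl⟩ := exists_mem_lpMeas_shift_eq hgen hU c hf'
    exact ⟨⟨g, hg⟩, rfl⟩
  exact ⟨LinearIsometryEquiv.ofSurjective T hT, (hU c).isShift fun f => rfl⟩

end PoissonShift

/-! ### The product system -/

theorem eventVector_univ_ne_zero {Ω : Type*} [MeasurableSpace Ω] {μ : Measure Ω}
    [IsProbabilityMeasure μ] : eventVector μ Set.univ ≠ 0 := by
  intro h
  have h1 := eventVector_coeFn (μ := μ) MeasurableSet.univ
  rw [h] at h1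
  have h2 : ∀ᵐ _ ∂μ, False := by
    filter_upwards [h1, Lp.coeFn_zero ℂ 2 μ] with ω e1 e2
    rw [e2] at e1
    simp at e1
  obtain ⟨_, hω⟩ := h2.exists
  exact hω

section PoissonProduct

variable {d : ℕ} {P : PointedCone ℝ (EuclideanSpace ℝ (Fin d))} {Ω Y : Type*} [MeasurableSpace Ω]
  [MeasurableSpace Y] [AddAction (EuclideanSpace ℝ (Fin d)) Y] {μ : Measure Ω}
  {η : Ω → Measure Y} {lam : Measure Y} {X : Set Y}
  {U : EuclideanSpace ℝ (Fin d) → Lp ℂ 2 μ →ₗᵢ[ℂ] Lp ℂ 2 μ}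

section FibreAtZero

variable [IsProbabilityMeasure μ] [μ.IsComplete]

theorem eventVector_univ_mem (hη : IsPoissonProcess μ η lam) (L : Set Y) :
    eventVector μ Set.univ ∈ lpMeas ℂ ℂ (countAlgebra μ η L) 2 μ :=
  eventVector_mem_lpMeas (countAlgebra_le hη.measurable L)
    (@MeasurableSet.univ Ω (countAlgebra μ η L))

/-- The region from `0` to `0` is empty, so that the fibre over `0` consists of the constants. -/
theorem finrank_regionL2_zero [MeasurableSpace.CountablyGenerated Y] [SigmaFinite lam]
    (hη : IsPoissonProcess μ η lam) : Module.finrank ℂ (regionL2 P μ η X 0 0) = 1 := by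
  obtain ⟨A, hA⟩ := exists_isDynkinGenerating lam
  refine finrank_eq_one (⟨_, eventVector_univ_mem hη _⟩ : regionL2 P μ η X 0 0)
    (fun h => eventVector_univ_ne_zero (congrArg Subtype.val h)) fun w => ?_
  have hR : MeasurableSet (region P X 0 0) := by
    rw [region_self]
    exact .empty
  have hle : Submodule.span ℂ (Set.range fun l => eventVector μ (countEvent η
      (fun n => A n ∩ region P X 0 0) l)) ≤ Submodule.span ℂ {eventVector μ Set.univ} := by
    refine Submodule.span_le.2 ?_
    rintro _ ⟨l, rfl⟩
    -- an event about the process in the empty region is either certain or impossible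
    by_cases h : ∀ p ∈ l, p.2 = 0
    · have : countEvent η (fun n => A n ∩ region P X 0 0) l = Set.univ := by
        refine Set.eq_univ_of_forall fun ω p hp => ?_
        simp only [region_self, Set.inter_empty, measure_empty, h p hp, Nat.cast_zero]
      change eventVector μ (countEvent η (fun n => A n ∩ region P X 0 0) l) ∈ _
      rw [this]
      exact Submodule.mem_span_singleton_self _
    · have : countEvent η (fun n => A n ∩ region P X 0 0) l = ∅ := by
        refine Set.eq_empty_of_forall_notMem fun ω hω => h fun p hp => ?_
        have := hω p hp
        simp only [region_self, Set.inter_empty, measure_empty] at this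
        exact_mod_cast this.symm
      change eventVector μ (countEvent η (fun n => A n ∩ region P X 0 0) l) ∈ _
      rw [this, eventVector_of_measurableSet .empty, indicatorConstLp_empty]
      exact Submodule.zero_mem _
  have hw := Submodule.topologicalClosure_mono hle (hη.mem_closure_span_countEvent hA hR w.2)
  rw [(Submodule.closed_of_finiteDimensional _).submodule_topologicalClosure_eq,
    Submodule.mem_span_singleton] at hw
  obtain ⟨z, hz⟩ := hw
  exact ⟨z, Subtype.ext hz⟩

end FibreAtZero

variable [MeasurableVAdd₂ (EuclideanSpace ℝ (Fin d)) Y]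

theorem shift_mem_regionL2 (hU : ∀ c, IsCountShift μ η c (U c)) {a b : P} {g : Lp ℂ 2 μ}
    (hg : g ∈ regionL2 P μ η X 0 b) : U a g ∈ regionL2 P μ η X (0 + a) (b + a) := by
  have := (hU a).mem_lpMeas hg
  rwa [vadd_region] at this

variable [IsProbabilityMeasure μ]

theorem indepFun_shift (hη : IsPoissonProcess μ η lam) (hU : ∀ c, IsCountShift μ η c (U c))
    {a b : P} {f f' g g' : Lp ℂ 2 μ} (hf : f ∈ regionL2 P μ η X 0 a)
    (hf' : f' ∈ regionL2 P μ η X 0 a) (hg : g ∈ regionL2 P μ η X 0 b)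
    (hg' : g' ∈ regionL2 P μ η X 0 b) :
    IndepFun (fun ω => (f ω, f' ω)) (fun ω => (U a g ω, U a g' ω)) μ :=
  hη.indepFun_lpMeas (disjoint_region a b) hf hf' (shift_mem_regionL2 hU hg)
    (shift_mem_regionL2 hU hg')

theorem memLp_mul_shift (hη : IsPoissonProcess μ η lam) (hU : ∀ c, IsCountShift μ η c (U c))
    {a b : P} {f g : Lp ℂ 2 μ} (hf : f ∈ regionL2 P μ η X 0 a) (hg : g ∈ regionL2 P μ η X 0 b) :
    MemLp (fun ω => f ω * U a g ω) 2 μ :=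
  memLp_two_mul_of_indepFun ((indepFun_shift hη hU hf hf hg hg).comp measurable_fst measurable_fst)

/-- The multiplication is isometric on elementary tensors: the factors depend on the process in
disjoint regions. -/
theorem inner_mulL2_shift (hη : IsPoissonProcess μ η lam) (hU : ∀ c, IsCountShift μ η c (U c))
    {a b : P} {f f' g g' : Lp ℂ 2 μ} (hf : f ∈ regionL2 P μ η X 0 a)
    (hf' : f' ∈ regionL2 P μ η X 0 a) (hg : g ∈ regionL2 P μ η X 0 b)
    (hg' : g' ∈ regionL2 P μ η X 0 b) :
    ⟪mulL2 f (U a g), mulL2 f' (U a g')⟫_ℂ = ⟪f, f'⟫_ℂ * ⟪g, g'⟫_ℂ := by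
  rw [inner_mulL2_of_indepFun (indepFun_shift hη hU hf hf' hg hg'), LinearIsometry.inner_map_map]

theorem norm_mulL2_shift (hη : IsPoissonProcess μ η lam) (hU : ∀ c, IsCountShift μ η c (U c))
    {a b : P} {f g : Lp ℂ 2 μ} (hf : f ∈ regionL2 P μ η X 0 a) (hg : g ∈ regionL2 P μ η X 0 b) :
    ‖mulL2 f (U a g)‖ = ‖f‖ * ‖g‖ := by
  have h := inner_mulL2_shift hη hU hf hf hg hg
  simp only [inner_self_eq_norm_sq_to_K, ← mul_pow] at h
  have h' : (‖mulL2 f (U a g)‖ ^ 2 : ℝ) = (‖f‖ * ‖g‖) ^ 2 := by exact_mod_cast h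
  exact (pow_left_inj₀ (norm_nonneg _) (by positivity) two_ne_zero).1 h'

theorem mulL2_shift_mem (hη : IsPoissonProcess μ η lam) (hU : ∀ c, IsCountShift μ η c (U c))
    (hX : ∀ a ∈ P, ∀ x ∈ X, a +ᵥ x ∈ X) {a b : P} {f g : Lp ℂ 2 μ}
    (hf : f ∈ regionL2 P μ η X 0 a) (hg : g ∈ regionL2 P μ η X 0 b) :
    mulL2 f (U a g) ∈ regionL2 P μ η X 0 (a + b) := by
  have h1 := (mem_lpMeas_iff_aestronglyMeasurable.1 hf).mono
    (countAlgebra_mono (region_subset_left hX a b))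
  have h2 := (mem_lpMeas_iff_aestronglyMeasurable.1 (shift_mem_regionL2 hU hg)).mono
    (countAlgebra_mono (region_subset_right hX a b))
  exact mem_lpMeas_iff_aestronglyMeasurable.2
    ((h1.mul h2).congr (mulL2_coeFn (memLp_mul_shift hη hU hf hg)).symm)

/-- On a pair of fibres, where all products are square integrable, the multiplication is
bilinear. -/
theorem exists_bilin_eq_mulL2_shift (hη : IsPoissonProcess μ η lam)
    (hU : ∀ c, IsCountShift μ η c (U c)) (a b : P) :
    ∃ M : regionL2 P μ η X 0 a →ₗ[ℂ] regionL2 P μ η X 0 b →ₗ[ℂ] Lp ℂ 2 μ,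
      ∀ f g, M f g = mulL2 (f : Lp ℂ 2 μ) (U a g) := by
  have h : ∀ f ∈ regionL2 P μ η X 0 a, ∀ g ∈ (regionL2 P μ η X 0 b).map (U a).toLinearMap,
      MemLp (fun ω => f ω * g ω) 2 μ := by
    rintro f hf _ ⟨g, hg, rfl⟩
    exact memLp_mul_shift hη hU hf hg
  exact ⟨(mulL2Bilin _ _ h).compl₂ ((U a).toLinearMap.submoduleMap _), fun f g => rfl⟩

/-- Associativity amounts to the multiplicativity of the shift and to `U (a + b) = U a ∘ U b`. -/
theorem mulL2_shift_assoc
    (hgen : ∀ A : Set Ω, MeasurableSet A → MeasurableSet[countAlgebra μ η Set.univ] A)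
    (hη : IsPoissonProcess μ η lam) (hU : ∀ c, IsCountShift μ η c (U c))
    (hX : ∀ a ∈ P, ∀ x ∈ X, a +ᵥ x ∈ X) {a b c : P} {f g h : Lp ℂ 2 μ}
    (hf : f ∈ regionL2 P μ η X 0 a) (hg : g ∈ regionL2 P μ η X 0 b)
    (hh : h ∈ regionL2 P μ η X 0 c) :
    mulL2 (mulL2 f (U a g)) (U ((a + b : P) : EuclideanSpace ℝ (Fin d)) h) =
      mulL2 f (U a (mulL2 g (U b h))) := by
  refine mulL2_eq ?_
  have h1 := mulL2_coeFn (memLp_mul_shift hη hU hf (mulL2_shift_mem hη hU hX hg hh))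
  have h2 := (hU a).coeFn_mul hgen (mulL2_coeFn (memLp_mul_shift hη hU hg hh))
  have h3 := mulL2_coeFn (memLp_mul_shift hη hU hf hg)
  have h4 : U a (U b h) = U ((a + b : P) : EuclideanSpace ℝ (Fin d)) h :=
    (hU a).comp_apply hgen (hU b) (hU _) rfl h
  filter_upwards [h1, h2, h3] with ω e1 e2 e3
  rw [e1, e2, e3, h4, mul_assoc]

/-- The products of the fundamental sections are again indicators of counting events about jointly
measurable families of sets. -/
theorem measurable_mulL2_shift_eventVector [SigmaFinite lam]
    [SecondCountableTopology (Lp ℂ 2 μ)] [MeasurableSpace (Lp ℂ 2 μ)] [BorelSpace (Lp ℂ 2 μ)]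
    (hη : IsPoissonProcess μ η lam)
    (hU : ∀ c, IsCountShift μ η c (U c)) {A : ℕ → Set Y} (hA : IsDynkinGenerating lam A)
    (hX : MeasurableSet X) (l l' : List (ℕ × ℕ)) :
    Measurable fun z : P × P =>
      mulL2 (eventVector μ (countEvent η (fun k => A k ∩ region P X 0 z.1) l))
        (U z.1 (eventVector μ (countEvent η (fun k => A k ∩ region P X 0 z.2) l'))) := by
  let F : P × P → ℕ ⊕ ℕ → Set Y := fun z => Sum.elim (fun k => A k ∩ region P X 0 z.1)
    fun k => (z.1 : EuclideanSpace ℝ (Fin d)) +ᵥ (A k ∩ region P X 0 z.2)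
  let L : List ((ℕ ⊕ ℕ) × ℕ) := l.map (Prod.map Sum.inl id) ++ l'.map (Prod.map Sum.inr id)
  have hm : ∀ (a : P) k, MeasurableSet (A k ∩ region P X 0 a) := fun a k =>
    (hA.measurableSet k).inter (measurableSet_region hX _ _)
  have key : ∀ z : P × P,
      mulL2 (eventVector μ (countEvent η (fun k => A k ∩ region P X 0 z.1) l))
        (U z.1 (eventVector μ (countEvent η (fun k => A k ∩ region P X 0 z.2) l'))) =
      eventVector μ (countEvent η (F z) L) := by
    intro z
    rw [(hU z.1).eventVector_countEvent hη (hm z.2), mulL2_eventVector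
      (measurableSet_countEvent (fun k => hη.measurable_count (hm z.1 k)) l)
      (measurableSet_countEvent (fun k => hη.measurable_count ((hm z.2 k).const_vadd _)) l')]
    congr 1
    ext ω
    simp only [countEvent, L, F, Set.mem_inter_iff, Set.mem_ofPred_eq, List.mem_append,
      List.mem_map, or_imp, forall_and, forall_exists_index, and_imp, forall_apply_eq_imp_iff₂,
      Prod.map_fst, Prod.map_snd, Sum.elim_inl, Sum.elim_inr, id_eq]
  simp only [key]
  refine hη.measurable_eventVector_countEvent ?_ L
  rintro (k | k)
  · exact (measurable_snd (hA.measurableSet k)).inter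
      (measurableSet_region_family hX measurable_fst)
  · exact measurableSet_vadd_family (measurable_subtype_coe.comp measurable_fst)
      (B := fun z : P × P => A k ∩ region P X 0 z.2)
      ((measurable_snd (hA.measurableSet k)).inter (measurableSet_region_family hX measurable_snd))

variable [μ.IsComplete]

/-- The events of the fibre over `a + b` are generated by intersections of events about the region
of `a` and events about the region from `a` to `a + b`, whose indicators are products. -/
theorem mem_closure_span_mulL2_shift [MeasurableSpace.CountablyGenerated Y] [SigmaFinite lam]
    (hη : IsPoissonProcess μ η lam)
    (hgen : ∀ A : Set Ω, MeasurableSet A → MeasurableSet[countAlgebra μ η Set.univ] A)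
    (hU : ∀ c, IsCountShift μ η c (U c)) (hXm : MeasurableSet X) {a b : P} {f : Lp ℂ 2 μ}
    (hf : f ∈ regionL2 P μ η X 0 (a + b)) :
    f ∈ (Submodule.span ℂ (Set.range fun x : regionL2 P μ η X 0 a × regionL2 P μ η X 0 b =>
      mulL2 (x.1 : Lp ℂ 2 μ) (U a x.2))).topologicalClosure := by
  obtain ⟨A, hA⟩ := exists_isDynkinGenerating lam
  set R₁ := region P X 0 a
  set R₂ := region P X (0 + a) (b + a)
  have hR₁ : MeasurableSet R₁ := measurableSet_region hXm _ _
  have hR₂ : MeasurableSet R₂ := measurableSet_region hXm _ _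
  let C : Set (Set Ω) := Set.range fun l : List (ℕ × ℕ) × List (ℕ × ℕ) =>
    countEvent η (fun n => A n ∩ R₁) l.1 ∩ countEvent η (fun n => A n ∩ R₂) l.2
  have hev : ∀ R, MeasurableSet R → ∀ l, MeasurableSet (countEvent η (fun n => A n ∩ R) l) :=
    fun R hR => measurableSet_countEvent fun n =>
      hη.measurable_count ((hA.measurableSet n).inter hR)
  have hnil : ∀ R, countEvent η (fun n => A n ∩ R) [] = Set.univ := fun R => by simp [countEvent]
  have hC : IsPiSystem C := by
    rintro _ ⟨l, rfl⟩ _ ⟨l', rfl⟩ hne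
    obtain ⟨k₁, hk₁⟩ := isPiSystem_countEvent η (fun n => A n ∩ R₁) _ ⟨l.1, rfl⟩ _ ⟨l'.1, rfl⟩
      (hne.mono fun ω h => ⟨h.1.1, h.2.1⟩)
    obtain ⟨k₂, hk₂⟩ := isPiSystem_countEvent η (fun n => A n ∩ R₂) _ ⟨l.2, rfl⟩ _ ⟨l'.2, rfl⟩
      (hne.mono fun ω h => ⟨h.1.2, h.2.2⟩)
    refine ⟨(k₁, k₂), ?_⟩
    change countEvent η _ k₁ ∩ countEvent η _ k₂ = _
    rw [hk₁, hk₂, Set.inter_inter_inter_comm]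
  have hm : MeasurableSpace.generateFrom C ≤ ‹MeasurableSpace Ω› := by
    refine MeasurableSpace.generateFrom_le ?_
    rintro _ ⟨l, rfl⟩
    exact (hev R₁ hR₁ _).inter (hev R₂ hR₂ _)
  have h1 := hη.countAlgebra_le_of_countEvent (m := MeasurableSpace.generateFrom C) hA hR₁ fun l =>
    MeasurableSpace.measurableSet_generateFrom ⟨(l, []), by simp only [hnil, Set.inter_univ]⟩
  have h2 := hη.countAlgebra_le_of_countEvent (m := MeasurableSpace.generateFrom C) hA hR₂ fun l =>
    MeasurableSpace.measurableSet_generateFrom ⟨([], l), by simp only [hnil, Set.univ_inter]⟩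
  have hle : countAlgebra μ η (region P X 0 (a + b)) ≤
      @eventuallyMeasurableSpace Ω (MeasurableSpace.generateFrom C) (ae μ) inferInstance := by
    refine countAlgebra_le_of_measurable fun B hB hBR => ?_
    have hsplit : (fun ω => η ω B) = fun ω => η ω (B ∩ R₁) + η ω (B ∩ R₂) := by
      funext ω
      rw [← measure_union ((disjoint_region a b).mono Set.inter_subset_right
        Set.inter_subset_right) (hB.inter hR₂), ← Set.inter_union_distrib_left,
        Set.inter_eq_left.2 (hBR.trans (region_subset_union a b))]
    rw [hsplit]
    exact @Measurable.add _ _ _ _ _ (_) _ _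
      ((measurable_count_countAlgebra (hB.inter hR₁) Set.inter_subset_right).mono h1 le_rfl)
      ((measurable_count_countAlgebra (hB.inter hR₂) Set.inter_subset_right).mono h2 le_rfl)
  have hprod : ∀ l : List (ℕ × ℕ) × List (ℕ × ℕ),
      eventVector μ (countEvent η (fun n => A n ∩ R₁) l.1 ∩ countEvent η (fun n => A n ∩ R₂) l.2) ∈
      (Submodule.span ℂ (Set.range fun x : regionL2 P μ η X 0 a × regionL2 P μ η X 0 b =>
        mulL2 (x.1 : Lp ℂ 2 μ) (U a x.2))).topologicalClosure := by
    intro l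
    have hmem₂ := hη.eventVector_countEvent_mem hA hR₂ l.2
    simp only [R₂, ← vadd_region_zero] at hmem₂
    obtain ⟨g, hg, hgU⟩ := exists_mem_lpMeas_shift_eq hgen hU a hmem₂
    refine Submodule.le_topologicalClosure _ (Submodule.subset_span
      ⟨(⟨_, hη.eventVector_countEvent_mem hA hR₁ l.1⟩, ⟨g, hg⟩), ?_⟩)
    simp only [hgU, vadd_region_zero]
    exact mulL2_eventVector (hev R₁ hR₁ _) (hev R₂ hR₂ _)
  refine mem_of_eventVector_mem hm rfl hC (Submodule.isClosed_topologicalClosure _) ?_ ?_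
    (aestronglyMeasurable_of_eventuallyMeasurableSpace
      ((mem_lpMeas_iff_aestronglyMeasurable.1 hf).mono hle))
  · simpa only [hnil, Set.univ_inter] using hprod ([], [])
  · rintro _ ⟨l, rfl⟩
    exact hprod l

variable [SigmaFinite lam] [SecondCountableTopology (Lp ℂ 2 μ)] [MeasurableSpace (Lp ℂ 2 μ)]
  [BorelSpace (Lp ℂ 2 μ)]

/-- The sections `a ↦ 1{η(A n ∩ R a) = k, …}`, where `R a` is the region of `a`. -/
theorem isFundamentalSequence_countEvent (hη : IsPoissonProcess μ η lam) {A : ℕ → Set Y}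
    (hA : IsDynkinGenerating lam A) (hX : MeasurableSet X) :
    IsFundamentalSequence (fun a : P => regionL2 P μ η X 0 a) fun n a =>
      eventVector μ (countEvent η (fun k => A k ∩ region P X 0 a)
        (Denumerable.ofNat (List (ℕ × ℕ)) n)) := by
  refine ⟨fun a => ?_, fun n => ?_, fun n a => ?_, fun a f hf => ?_⟩
  · exact isClosed_aestronglyMeasurable (countAlgebra_le hη.measurable _)
  · refine hη.measurable_eventVector_countEvent (fun k => ?_) _
    exact (measurable_snd (hA.measurableSet k)).inter (measurableSet_region_family hX measurable_id)
  · exact hη.eventVector_countEvent_mem hA (measurableSet_region hX _ _) _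
  · have h := hη.mem_closure_span_countEvent hA (measurableSet_region hX _ _) hf
    have hr : (Set.range fun n => eventVector μ (countEvent η (fun k => A k ∩ region P X 0 a)
        (Denumerable.ofNat (List (ℕ × ℕ)) n))) = Set.range fun l =>
          eventVector μ (countEvent η (fun k => A k ∩ region P X 0 a) l) :=
      (Denumerable.eqv (List (ℕ × ℕ))).symm.surjective.range_comp
        fun l => eventVector μ (countEvent η (fun k => A k ∩ region P X 0 a) l)
    rw [hr]
    exact h

/-- The multiplication is Borel: being bounded and bilinear, it is approximated by its values on
finite combinations of the fundamental sections. -/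
theorem measurable_mulL2_shift [MeasurableSpace.CountablyGenerated Y]
    (hη : IsPoissonProcess μ η lam)
    (hU : ∀ c, IsCountShift μ η c (U c)) (hX : MeasurableSet X)
    {Z : Type*} [MeasurableSpace Z] {a b : Z → P} (ha : Measurable a) (hb : Measurable b)
    {f g : Z → Lp ℂ 2 μ} (hf : Measurable f) (hg : Measurable g)
    (hfa : ∀ z, f z ∈ regionL2 P μ η X 0 (a z)) (hgb : ∀ z, g z ∈ regionL2 P μ η X 0 (b z)) :
    Measurable fun z => mulL2 (f z) (U (a z) (g z)) := by
  obtain ⟨A, hA⟩ := exists_isDynkinGenerating lam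
  have hE := isFundamentalSequence_countEvent (P := P) hη hA hX
  set e : ℕ → P → Lp ℂ 2 μ := fun n a => eventVector μ (countEvent η
    (fun k => A k ∩ region P X 0 a) (Denumerable.ofNat (List (ℕ × ℕ)) n))
  let s : (Σ n : ℕ, Fin n → ℕ) → P → Lp ℂ 2 μ := fun j a => denseCombination (fun n => e n a) j
  have hs : ∀ j, Measurable (s j) := fun j => measurable_denseCombination hE.measurable j
  have hsm : ∀ j a, s j a ∈ regionL2 P μ η X 0 a := fun j a => hE.denseCombination_mem j a
  have hexp : ∀ (j k) (x y : P), mulL2 (s j x) (U x (s k y)) =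
      ∑ i : Fin j.1, ∑ i' : Fin k.1, (TopologicalSpace.denseSeq ℂ (j.2 i) *
        TopologicalSpace.denseSeq ℂ (k.2 i')) • mulL2 (e i x) (U x (e i' y)) := by
    intro j k x y
    obtain ⟨M, hM⟩ := exists_bilin_eq_mulL2_shift (X := X) hη hU x y
    have h1 : ∀ (j) (x : P), ((denseCombination
        (fun n => (⟨e n x, hE.mem n x⟩ : regionL2 P μ η X 0 x)) j :) : Lp ℂ 2 μ) = s j x := by
      intro j x
      simp only [denseCombination, s, Submodule.coe_sum, Submodule.coe_smul]
    have h2 := hM (denseCombination (fun n => (⟨e n x, hE.mem n x⟩ : regionL2 P μ η X 0 x)) j)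
      (denseCombination (fun n => (⟨e n y, hE.mem n y⟩ : regionL2 P μ η X 0 y)) k)
    rw [h1, h1] at h2
    rw [← h2]
    simp only [denseCombination, map_sum, LinearMap.sum_apply, map_smul, LinearMap.smul_apply, hM,
      Finset.smul_sum, smul_smul]
    rw [Finset.sum_comm]
    simp only [mul_comm]
  have hmeas : ∀ j k, Measurable fun z => mulL2 (s j (a z)) (U (a z) (s k (b z))) := by
    intro j k
    simp only [hexp]
    refine Finset.measurable_sum _ fun i _ => Finset.measurable_sum _ fun i' _ => ?_
    have h := (measurable_mulL2_shift_eventVector hη hU hA hX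
      (Denumerable.ofNat (List (ℕ × ℕ)) i) (Denumerable.ofNat (List (ℕ × ℕ)) i')).comp
        (ha.prodMk hb)
    exact h.const_smul (TopologicalSpace.denseSeq ℂ (j.2 i) * TopologicalSpace.denseSeq ℂ (k.2 i'))
  -- the error bound comes from `f * g - s * s' = (f - s) * g + s * (g - s')`
  refine measurable_of_dist_le (J := (Σ n : ℕ, Fin n → ℕ) × (Σ n : ℕ, Fin n → ℕ))
    (G := fun j z => mulL2 (s j.1 (a z)) (U (a z) (s j.2 (b z))))
    (r := fun j z => ‖f z - s j.1 (a z)‖ * ‖g z‖ + ‖s j.1 (a z)‖ * ‖g z - s j.2 (b z)‖)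
    (fun j => hmeas j.1 j.2) (fun j => ?_) (fun j z => ?_) fun z ε hε => ?_
  · have h1 := (hs j.1).comp ha
    have h2 := (hs j.2).comp hb
    exact ((hf.sub h1).norm.mul hg.norm).add (h1.norm.mul (hg.sub h2).norm)
  · obtain ⟨M, hM⟩ := exists_bilin_eq_mulL2_shift (X := X) hη hU (a z) (b z)
    have hsplit := congrArg₂ (· - ·) (hM ⟨f z, hfa z⟩ ⟨g z, hgb z⟩)
      (hM ⟨s j.1 (a z), hsm _ _⟩ ⟨s j.2 (b z), hsm _ _⟩)
    have hbil : M ⟨f z, hfa z⟩ ⟨g z, hgb z⟩ - M ⟨s j.1 (a z), hsm _ _⟩ ⟨s j.2 (b z), hsm _ _⟩ =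
        M (⟨f z, hfa z⟩ - ⟨s j.1 (a z), hsm _ _⟩) ⟨g z, hgb z⟩ +
          M ⟨s j.1 (a z), hsm _ _⟩ (⟨g z, hgb z⟩ - ⟨s j.2 (b z), hsm _ _⟩) := by
      simp only [map_sub, LinearMap.sub_apply]
      abel
    rw [dist_eq_norm]
    refine (le_of_eq (congrArg norm (hsplit.symm.trans hbil))).trans ((norm_add_le _ _).trans ?_)
    refine add_le_add (le_of_eq ?_) (le_of_eq ?_)
    · rw [hM]
      exact norm_mulL2_shift hη hU (Submodule.coe_mem _) (Submodule.coe_mem _)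
    · rw [hM]
      exact norm_mulL2_shift hη hU (Submodule.coe_mem _) (Submodule.coe_mem _)
  · have happ : ∀ (x : P) (v : Lp ℂ 2 μ), v ∈ regionL2 P μ η X 0 x → ∀ c : ℝ, 0 ≤ c →
        ∃ j, c * ‖v - s j x‖ < ε / 2 := by
      intro x v hv c hc
      obtain ⟨_, ⟨j, rfl⟩, hj⟩ := Metric.mem_closure_iff.1
        (hE.subset_closure_denseCombination x hv) (ε / 2 / (c + 1)) (by positivity)
      refine ⟨j, ?_⟩
      rw [dist_eq_norm, lt_div_iff₀ (by positivity)] at hj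
      refine lt_of_le_of_lt ?_ hj
      rw [mul_comm]
      exact mul_le_mul_of_nonneg_left (by linarith) (norm_nonneg _)
    -- the second approximation is chosen after the first, whose norm enters its error
    obtain ⟨j, hj⟩ := happ (a z) (f z) (hfa z) ‖g z‖ (norm_nonneg _)
    obtain ⟨k, hk⟩ := happ (b z) (g z) (hgb z) ‖s j (a z)‖ (norm_nonneg _)
    refine ⟨(j, k), ?_⟩
    rw [mul_comm] at hj
    change ‖f z - s j (a z)‖ * ‖g z‖ + ‖s j (a z)‖ * ‖g z - s k (b z)‖ < ε
    linarith

end PoissonProduct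

end

theorem mainTheorem3 {d : ℕ} (P : PointedCone ℝ (EuclideanSpace ℝ (Fin d)))
    (hP_closed : IsClosed (P : Set (EuclideanSpace ℝ (Fin d))))
    (hP_spanning : ∀ x : EuclideanSpace ℝ (Fin d), ∃ a ∈ P, ∃ b ∈ P, x = a - b)
    (hP_salient : ∀ x : EuclideanSpace ℝ (Fin d), x ∈ P → -x ∈ P → x = 0)
    {Y : Type*} [MeasurableSpace Y] [MeasurableSpace.CountablyGenerated Y]
    [AddAction (EuclideanSpace ℝ (Fin d)) Y] [MeasurableVAdd₂ (EuclideanSpace ℝ (Fin d)) Y]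
    (lam : Measure Y) [SigmaFinite lam] [VAddInvariantMeasure (EuclideanSpace ℝ (Fin d)) Y lam]
    (X : Set Y) (hX : MeasurableSet X)
    (hX_invariant : ∀ a ∈ P, ∀ x ∈ X, a +ᵥ x ∈ X)
    (hX_pure : ⋂ a ∈ P, (a +ᵥ X) = ∅)
    {Ω : Type*} [MeasurableSpace Ω] (μ : Measure Ω) [IsProbabilityMeasure μ] [μ.IsComplete]
    (η : Ω → Measure Y) (hη : IsPoissonProcess μ η lam)
    (hη_generates : ∀ A : Set Ω, MeasurableSet A → MeasurableSet[countAlgebra μ η Set.univ] A) :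
    (∀ c a b : P, (b : EuclideanSpace ℝ (Fin d)) - a ∈ P →
      ∃! S : regionL2 P μ η X a b ≃ₗᵢ[ℂ] regionL2 P μ η X (a + c) (b + c),
        IsShift P μ η X c a b S) ∧
    MeasurableSet[@Prod.instMeasurableSpace P (Lp ℂ 2 μ) inferInstance (borel _)]
      {x : P × Lp ℂ 2 μ | x.2 ∈ regionL2 P μ η X 0 x.1} ∧
    ∀ S : ∀ a b : P, regionL2 P μ η X 0 b ≃ₗᵢ[ℂ] regionL2 P μ η X (0 + a) (b + a),
      (∀ a b, IsShift P μ η X a 0 b (S a b)) →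
      ∃ mul : ∀ a b : P, poissonFibre P μ η X a → poissonFibre P μ η X b →
          poissonFibre P μ η X (a + b),
        (∀ a b f g, ((mul a b f g : Lp ℂ 2 μ) : Ω → ℂ) =ᵐ[μ]
          fun ω => (f : Lp ℂ 2 μ) ω * (S a b g : Lp ℂ 2 μ) ω) ∧
        IsProductSystem (poissonFibre P μ η X) mul := by
  choose U hU using fun c => hη.exists_isCountShift (G := EuclideanSpace ℝ (Fin d)) hη_generates c
  have := hη.secondCountableTopology_L2 hη_generates
  let _ : MeasurableSpace (Lp ℂ 2 μ) := borel _
  have : BorelSpace (Lp ℂ 2 μ) := ⟨rfl⟩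
  obtain ⟨A, hA⟩ := exists_isDynkinGenerating lam
  have hE := isFundamentalSequence_countEvent (P := P) hη hA hX
  refine ⟨fun c a b _ => ?_, hE.measurableSet_graph, fun S hS => ?_⟩
  · obtain ⟨S, hS⟩ := exists_isShift (X := X) hη_generates hU c a b
    refine ⟨S, hS, fun S' hS' => LinearIsometryEquiv.ext fun f => Subtype.ext ?_⟩
    rw [(hU c).eq_of_isShift hη hX hS', (hU c).eq_of_isShift hη hX hS]
  have hSU : ∀ a b g, (S a b g : Lp ℂ 2 μ) = U a g := fun a b g =>
    (hU a).eq_of_isShift hη hX (hS a b) g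
  let mul : ∀ a b : P, poissonFibre P μ η X a → poissonFibre P μ η X b →
      poissonFibre P μ η X (a + b) := fun a b f g =>
    ⟨mulL2 (f : Lp ℂ 2 μ) (U a g), mulL2_shift_mem hη hU hX_invariant f.2 g.2⟩
  have hmulM : ∀ a b, ∃ M : regionL2 P μ η X 0 a →ₗ[ℂ] regionL2 P μ η X 0 b →ₗ[ℂ] Lp ℂ 2 μ,
      ∀ f g, (mul a b f g : Lp ℂ 2 μ) = M f g := fun a b =>
    (exists_bilin_eq_mulL2_shift hη hU a b).imp fun M hM f g => (hM f g).symm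
  have hm : poissonTotalSpace P μ η X =
      MeasurableSpace.comap (totalInclusion fun a : P => regionL2 P μ η X 0 a) inferInstance := rfl
  have : StandardBorelSpace P := hP_closed.measurableSet.standardBorel
  refine ⟨mul, fun a b f g => ?_, ?_⟩
  · rw [hSU]
    exact mulL2_coeFn (memLp_mul_shift hη hU f.2 g.2)
  exact {
    standardBorel := hE.standardBorelSpace hm
    measurable_base := (measurable_totalInclusion hm).fst
    measurableField := hE.isMeasurableField hm
    nontrivial := fun a => ⟨⟨_, eventVector_univ_mem hη _⟩, 0, fun h =>
      eventVector_univ_ne_zero (congrArg Subtype.val h)⟩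
    finrank_zero := finrank_regionL2_zero hη
    measurable_add := measurable_totalSpace_add hm
    measurable_smul := measurable_totalSpace_smul hm
    measurable_inner := measurable_totalSpace_inner hm
    add_mul := fun a b u u' v => Subtype.ext <| by
      obtain ⟨M, hM⟩ := hmulM a b
      simp only [Submodule.coe_add, hM, map_add, LinearMap.add_apply]
    mul_add := fun a b u v v' => Subtype.ext <| by
      obtain ⟨M, hM⟩ := hmulM a b
      simp only [Submodule.coe_add, hM, map_add]
    smul_mul := fun a b z u v => Subtype.ext <| by
      obtain ⟨M, hM⟩ := hmulM a b
      simp only [Submodule.coe_smul, hM, map_smul, LinearMap.smul_apply]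
    mul_smul := fun a b z u v => Subtype.ext <| by
      obtain ⟨M, hM⟩ := hmulM a b
      simp only [Submodule.coe_smul, hM, map_smul]
    inner_mul := fun a b u u' v v' => inner_mulL2_shift hη hU u.2 u'.2 v.2 v'.2
    total_mul := fun a b => dense_span_range_of_subset_closure fun f hf =>
      mem_closure_span_mulL2_shift hη hη_generates hU hX hf
    -- the two sides lie in different fibres, over `(a + b) + c` and `a + (b + c)`
    mul_assoc := fun a b c u v w => totalInclusion_injective <| Prod.ext (add_assoc a b c)
      (mulL2_shift_assoc hη_generates hη hU hX_invariant u.2 v.2 w.2)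
    measurable_mul := by
      have h1 := (measurable_totalInclusion hm).comp
        (measurable_fst : Measurable (Prod.fst : TotalSpace (poissonFibre P μ η X) ×
          TotalSpace (poissonFibre P μ η X) → _))
      have h2 := (measurable_totalInclusion hm).comp
        (measurable_snd : Measurable (Prod.snd : TotalSpace (poissonFibre P μ η X) ×
          TotalSpace (poissonFibre P μ η X) → _))
      exact measurable_toTotalSpace hm
        (((measurable_subtype_coe.comp h1.fst).add
          (measurable_subtype_coe.comp h2.fst)).subtype_mk)
        (measurable_mulL2_shift hη hU hX h1.fst h2.fst h1.snd h2.snd (fun x => x.1.vec.2)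
          fun x => x.2.vec.2) }
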